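/- **Conventions.** Let $\mathfrak{so}(6)$ be the real skew-symmetric $6\times6$ matrices (indices $0,\dots,5$), $R_{ab}=E_{ab}-E_{ba}$, and let $\mathfrak{su}(4)$ be the traceless skew-Hermitian $4\times 4$ matrices. Let $\varphi:\mathfrak{so}(6)\to\mathfrak{su}(4)$ be the spin isomorphism of Lie algebras, $\varphi(R_{ab})=\tfrac12 s_a s_b^{*}$ for $a\ne b$, where, with the Pauli matrices $\sigma_i$, $$s_0=1,\quad s_1=-i\,1\otimes\sigma_3,\quad s_2=-i\,1\otimes\sigma_1,\quad s_3=i\,\sigma_2\otimes\sigma_2,\quad s_4=-i\,\sigma_1\otimes\sigma_2,\quad s_5=-i\,\sigma_3\otimes\sigma_2$$ (so that $s_as_b^*+s_bs_a^*=2\delta_{ab}$). For a Lie subalgebra $\mathfrak h\subset\mathfrak{so}(6)$ let $G_{\mathfrak h}\subset SO(6)$ be the connected subgroup generated by $\{\exp X: X\in\mathfrak h\}$, and let $UG_{\mathfrak h}\subset SU(4)$ be the connected subgroup generated by $\{\exp\varphi(X):X\in\mathfrak h\}$. Let $\mathfrak{ug}_{\Join}\subset\mathfrak{su}(4)$ be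 the Lie subalgebra generated by $$J_1=\tfrac i2\,1\otimes\sigma_2,\quad J_2=\tfrac i2\,1\otimes\sigma_1,\quad J_3=\tfrac i2\,1\otimes\sigma_3,\quad K_1=-\tfrac i2\,\sigma_2\otimes\sigma_2,\quad K_2=\tfrac i2\,\sigma_2\otimes\sigma_1,\quad K_3=-\tfrac i2\,\sigma_2\otimes\sigma_3 ,$$ and let $\mathfrak g_{\Join}=\varphi^{-1}(\mathfrak{ug}_{\Join})\subset\mathfrak{so}(6)$ be the corresponding subalgebra. Let $\mathfrak g'_{\Join}\subset\mathfrak{so}(6)$ be the Lie subalgebra generated by the sums $\overset{\curvearrowright}{J}_i+\overset{\curvearrowleft}{J}_i$ $(i=1,2,3)$ and $K_3=R_{23}$, where $(\overset{\curvearrowright}{J}_1,\overset{\curvearrowright}{J}_2,\overset{\curvearrowright}{J}_3)=(R_{12},R_{02},R_{01})$ and $(\overset{\curvearrowleft}{J}_1,\overset{\curvearrowleft}{J}_2,\overset{\curvearrowleft}{J}_3)=(R_{43},R_{53},R_{54})$. **Theorem (twofold covering $\Xi:UG\to G$).** The algebra $\mathfrak g_{\Join}$ has dimension $6$, and $\varphi(\mathfrak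 g_{\Join})=\mathfrak{ug}_{\Join}$. Let $\mathfrak h$ be either of $\mathfrak g_{\Join}$ and $\mathfrak g'_{\Join}$, and put $G=G_{\mathfrak h}$, $UG=UG_{\mathfrak h}$. Then $G$ and $UG$ are closed subgroups of $SO(6)$ and of $SU(4)$, hence compact Lie groups, and there is a map $$\Xi: UG\longrightarrow G$$ that is a twofold covering epimorphism of Lie groups: $\Xi$ is a smooth surjective group homomorphism (indeed the restriction of a smooth map between the spaces of matrices) and a covering map all of whose fibres have exactly two elements. Moreover, $\Xi(\exp\varphi(X))=\exp X$ for all $X\in\mathfrak h$, so that $\Xi$ is a local isomorphism which induces the isomorphism $\varphi^{-1}$ of Lie algebras. -/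

import Mathlib

open Matrix
open scoped ContDiff

noncomputable section

attribute [local instance 100] LieRing.ofAssociativeRing

set_option linter.unusedSimpArgs false

namespace Superspin

/-- The Lie algebra `so(6)` of real skew-symmetric matrices. -/
abbrev so6 : LieSubalgebra ℝ (Matrix (Fin 6) (Fin 6) ℝ) := LieAlgebra.Orthogonal.so (Fin 6) ℝ

/-- The Lie algebra `su(4)` of traceless skew-Hermitian matrices, as a real Lie algebra. -/
def su4 : LieSubalgebra ℝ (Matrix (Fin 4) (Fin 4) ℂ) where
  carrier := {A | Aᴴ = -A ∧ A.trace = 0}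
  add_mem' := by
    rintro A B ⟨hA, hA'⟩ ⟨hB, hB'⟩
    refine ⟨?_, ?_⟩
    · rw [conjTranspose_add, hA, hB]; abel
    · rw [trace_add, hA', hB', add_zero]
  zero_mem' := by simp
  smul_mem' := by
    rintro c A ⟨hA, hA'⟩
    refine ⟨?_, ?_⟩
    · rw [conjTranspose_smul, hA]; simp
    · rw [trace_smul, hA', smul_zero]
  lie_mem' := by
    rintro A B ⟨hA, hA'⟩ ⟨hB, hB'⟩
    refine ⟨?_, ?_⟩
    · rw [Ring.lie_def, conjTranspose_sub, conjTranspose_mul, conjTranspose_mul, hA, hB]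
      noncomm_ring
    · rw [Ring.lie_def, trace_sub, trace_mul_comm, sub_self]

theorem mem_su4 (A : Matrix (Fin 4) (Fin 4) ℂ) : A ∈ su4 ↔ Aᴴ = -A ∧ A.trace = 0 := Iff.rfl

/-! ### The isomorphism between `so(6)` and `su(4)` -/

/-- The complex number `(x + i y) / 2`. -/
def half (x y : ℝ) : ℂ := ⟨1 / 2 * x, 1 / 2 * y⟩

theorem half_re (x y : ℝ) : (half x y).re = 1 / 2 * x := rfl

theorem half_im (x y : ℝ) : (half x y).im = 1 / 2 * y := rfl

/-- The half-spin representation of `so(6)`, in a basis of spinors: the element `E a b - E b a` is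
sent to `½ s a (s b)ᴴ`, where `s 0 = 1, s 1, …, s 5` are the chiral Dirac matrices of Euclidean
six-space, with `s a (s b)ᴴ + s b (s a)ᴴ = 2 δ_{ab}`. -/
def spinMatrix (X : Matrix (Fin 6) (Fin 6) ℝ) : Matrix (Fin 4) (Fin 4) ℂ :=
    !![half 0 (X 0 1 + X 2 5 + X 3 4),
        half (X 0 5 + X 1 2) (X 0 2 - X 1 5),
        half (-X 2 3 - X 4 5) (X 2 4 - X 3 5),
        half (X 0 4 + X 1 3) (X 0 3 - X 1 4);
      half (-X 0 5 - X 1 2) (X 0 2 - X 1 5),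
        half 0 (-X 0 1 - X 2 5 + X 3 4),
        half (-X 0 4 + X 1 3) (-X 0 3 - X 1 4),
        half (X 2 3 - X 4 5) (-X 2 4 - X 3 5);
      half (X 2 3 + X 4 5) (X 2 4 - X 3 5),
        half (X 0 4 - X 1 3) (-X 0 3 - X 1 4),
        half 0 (X 0 1 - X 2 5 - X 3 4),
        half (-X 0 5 + X 1 2) (X 0 2 + X 1 5);
      half (-X 0 4 - X 1 3) (X 0 3 - X 1 4),
        half (-X 2 3 + X 4 5) (-X 2 4 - X 3 5),
        half (X 0 5 - X 1 2) (X 0 2 + X 1 5),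
        half 0 (-X 0 1 + X 2 5 - X 3 4)]

/-- Half of the inverse of `spinMatrix` on `su(4)`: the entries above the diagonal. -/
def upperMatrix (A : Matrix (Fin 4) (Fin 4) ℂ) : Matrix (Fin 6) (Fin 6) ℝ :=
    !![0,
        (A 0 0).im + (A 2 2).im,
        (A 0 1).im + (A 2 3).im,
        (A 0 3).im - (A 1 2).im,
        (A 0 3).re - (A 1 2).re,
        (A 0 1).re - (A 2 3).re;
      0, 0,
        (A 0 1).re + (A 2 3).re,
        (A 0 3).re + (A 1 2).re,
        -(A 0 3).im - (A 1 2).im,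
        (A 2 3).im - (A 0 1).im;
      0, 0, 0,
        (A 1 3).re - (A 0 2).re,
        (A 0 2).im - (A 1 3).im,
        (A 0 0).im + (A 3 3).im;
      0, 0, 0, 0,
        (A 0 0).im + (A 1 1).im,
        -(A 0 2).im - (A 1 3).im;
      0, 0, 0, 0, 0, -(A 0 2).re - (A 1 3).re;
      0, 0, 0, 0, 0, 0]

section entries

variable (X : Matrix (Fin 6) (Fin 6) ℝ) (A : Matrix (Fin 4) (Fin 4) ℂ)

theorem spinMatrix_00 : spinMatrix X 0 0 = half 0 (X 0 1 + X 2 5 + X 3 4) := rfl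
theorem spinMatrix_01 : spinMatrix X 0 1 = half (X 0 5 + X 1 2) (X 0 2 - X 1 5) := rfl
theorem spinMatrix_02 : spinMatrix X 0 2 = half (-X 2 3 - X 4 5) (X 2 4 - X 3 5) := rfl
theorem spinMatrix_03 : spinMatrix X 0 3 = half (X 0 4 + X 1 3) (X 0 3 - X 1 4) := rfl
theorem spinMatrix_10 : spinMatrix X 1 0 = half (-X 0 5 - X 1 2) (X 0 2 - X 1 5) := rfl
theorem spinMatrix_11 : spinMatrix X 1 1 = half 0 (-X 0 1 - X 2 5 + X 3 4) := rfl
theorem spinMatrix_12 : spinMatrix X 1 2 = half (-X 0 4 + X 1 3) (-X 0 3 - X 1 4) := rfl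
theorem spinMatrix_13 : spinMatrix X 1 3 = half (X 2 3 - X 4 5) (-X 2 4 - X 3 5) := rfl
theorem spinMatrix_20 : spinMatrix X 2 0 = half (X 2 3 + X 4 5) (X 2 4 - X 3 5) := rfl
theorem spinMatrix_21 : spinMatrix X 2 1 = half (X 0 4 - X 1 3) (-X 0 3 - X 1 4) := rfl
theorem spinMatrix_22 : spinMatrix X 2 2 = half 0 (X 0 1 - X 2 5 - X 3 4) := rfl
theorem spinMatrix_23 : spinMatrix X 2 3 = half (-X 0 5 + X 1 2) (X 0 2 + X 1 5) := rfl
theorem spinMatrix_30 : spinMatrix X 3 0 = half (-X 0 4 - X 1 3) (X 0 3 - X 1 4) := rfl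
theorem spinMatrix_31 : spinMatrix X 3 1 = half (-X 2 3 + X 4 5) (-X 2 4 - X 3 5) := rfl
theorem spinMatrix_32 : spinMatrix X 3 2 = half (X 0 5 - X 1 2) (X 0 2 + X 1 5) := rfl
theorem spinMatrix_33 : spinMatrix X 3 3 = half 0 (-X 0 1 + X 2 5 - X 3 4) := rfl
theorem upperMatrix_00 : upperMatrix A 0 0 = 0 := rfl
theorem upperMatrix_01 : upperMatrix A 0 1 = (A 0 0).im + (A 2 2).im := rfl
theorem upperMatrix_02 : upperMatrix A 0 2 = (A 0 1).im + (A 2 3).im := rfl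
theorem upperMatrix_03 : upperMatrix A 0 3 = (A 0 3).im - (A 1 2).im := rfl
theorem upperMatrix_04 : upperMatrix A 0 4 = (A 0 3).re - (A 1 2).re := rfl
theorem upperMatrix_05 : upperMatrix A 0 5 = (A 0 1).re - (A 2 3).re := rfl
theorem upperMatrix_10 : upperMatrix A 1 0 = 0 := rfl
theorem upperMatrix_11 : upperMatrix A 1 1 = 0 := rfl
theorem upperMatrix_12 : upperMatrix A 1 2 = (A 0 1).re + (A 2 3).re := rfl
theorem upperMatrix_13 : upperMatrix A 1 3 = (A 0 3).re + (A 1 2).re := rfl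
theorem upperMatrix_14 : upperMatrix A 1 4 = -(A 0 3).im - (A 1 2).im := rfl
theorem upperMatrix_15 : upperMatrix A 1 5 = (A 2 3).im - (A 0 1).im := rfl
theorem upperMatrix_20 : upperMatrix A 2 0 = 0 := rfl
theorem upperMatrix_21 : upperMatrix A 2 1 = 0 := rfl
theorem upperMatrix_22 : upperMatrix A 2 2 = 0 := rfl
theorem upperMatrix_23 : upperMatrix A 2 3 = (A 1 3).re - (A 0 2).re := rfl
theorem upperMatrix_24 : upperMatrix A 2 4 = (A 0 2).im - (A 1 3).im := rfl
theorem upperMatrix_25 : upperMatrix A 2 5 = (A 0 0).im + (A 3 3).im := rfl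
theorem upperMatrix_30 : upperMatrix A 3 0 = 0 := rfl
theorem upperMatrix_31 : upperMatrix A 3 1 = 0 := rfl
theorem upperMatrix_32 : upperMatrix A 3 2 = 0 := rfl
theorem upperMatrix_33 : upperMatrix A 3 3 = 0 := rfl
theorem upperMatrix_34 : upperMatrix A 3 4 = (A 0 0).im + (A 1 1).im := rfl
theorem upperMatrix_35 : upperMatrix A 3 5 = -(A 0 2).im - (A 1 3).im := rfl
theorem upperMatrix_40 : upperMatrix A 4 0 = 0 := rfl
theorem upperMatrix_41 : upperMatrix A 4 1 = 0 := rfl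
theorem upperMatrix_42 : upperMatrix A 4 2 = 0 := rfl
theorem upperMatrix_43 : upperMatrix A 4 3 = 0 := rfl
theorem upperMatrix_44 : upperMatrix A 4 4 = 0 := rfl
theorem upperMatrix_45 : upperMatrix A 4 5 = -(A 0 2).re - (A 1 3).re := rfl
theorem upperMatrix_50 : upperMatrix A 5 0 = 0 := rfl
theorem upperMatrix_51 : upperMatrix A 5 1 = 0 := rfl
theorem upperMatrix_52 : upperMatrix A 5 2 = 0 := rfl
theorem upperMatrix_53 : upperMatrix A 5 3 = 0 := rfl
theorem upperMatrix_54 : upperMatrix A 5 4 = 0 := rfl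
theorem upperMatrix_55 : upperMatrix A 5 5 = 0 := rfl

end entries

/-- The inverse of `spinMatrix` on `su(4)`. -/
def vectorMatrix (A : Matrix (Fin 4) (Fin 4) ℂ) : Matrix (Fin 6) (Fin 6) ℝ :=
  upperMatrix A - (upperMatrix A)ᵀ

theorem vectorMatrix_apply (A : Matrix (Fin 4) (Fin 4) ℂ) (a b : Fin 6) :
    vectorMatrix A a b = upperMatrix A a b - upperMatrix A b a := rfl

theorem so6_apply (X : so6) (a b : Fin 6) : X.1 b a = -X.1 a b := by
  have h := (LieAlgebra.Orthogonal.mem_so (Fin 6) ℝ X.1).1 X.2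
  exact congrFun (congrFun h a) b

theorem so6_diag (X : so6) (a : Fin 6) : X.1 a a = 0 := by
  linarith [so6_apply X a a]

theorem spinMatrix_add (X Y : Matrix (Fin 6) (Fin 6) ℝ) :
    spinMatrix (X + Y) = spinMatrix X + spinMatrix Y := by
  ext i j
  rw [Matrix.add_apply]
  fin_cases i <;> fin_cases j <;>
    dsimp only [Fin.mk_zero, Fin.mk_one, Fin.reduceFinMk, Fin.zero_eta, Fin.isValue] <;>
    simp only [spinMatrix_00, spinMatrix_01, spinMatrix_02, spinMatrix_03, spinMatrix_10,
      spinMatrix_11, spinMatrix_12, spinMatrix_13, spinMatrix_20, spinMatrix_21,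
      spinMatrix_22, spinMatrix_23, spinMatrix_30, spinMatrix_31, spinMatrix_32,
      spinMatrix_33] <;>
    apply Complex.ext <;>
    simp only [Complex.add_re, Complex.add_im, half_re, half_im, Matrix.add_apply] <;>
    ring

theorem spinMatrix_smul (c : ℝ) (X : Matrix (Fin 6) (Fin 6) ℝ) :
    spinMatrix (c • X) = c • spinMatrix X := by
  ext i j
  rw [Matrix.smul_apply]
  fin_cases i <;> fin_cases j <;>
    dsimp only [Fin.mk_zero, Fin.mk_one, Fin.reduceFinMk, Fin.zero_eta, Fin.isValue] <;>
    simp only [spinMatrix_00, spinMatrix_01, spinMatrix_02, spinMatrix_03, spinMatrix_10,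
      spinMatrix_11, spinMatrix_12, spinMatrix_13, spinMatrix_20, spinMatrix_21,
      spinMatrix_22, spinMatrix_23, spinMatrix_30, spinMatrix_31, spinMatrix_32,
      spinMatrix_33] <;>
    apply Complex.ext <;>
    simp only [Complex.smul_re, Complex.smul_im, half_re, half_im, Matrix.smul_apply,
      smul_eq_mul] <;>
    ring

theorem spinMatrix_mem (X : Matrix (Fin 6) (Fin 6) ℝ) : spinMatrix X ∈ su4 := by
  rw [mem_su4]
  refine ⟨?_, ?_⟩
  · ext i j
    rw [conjTranspose_apply, Matrix.neg_apply]
    fin_cases i <;> fin_cases j <;>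
      dsimp only [Fin.mk_zero, Fin.mk_one, Fin.reduceFinMk, Fin.zero_eta, Fin.isValue] <;>
      simp only [spinMatrix_00, spinMatrix_01, spinMatrix_02, spinMatrix_03, spinMatrix_10,
      spinMatrix_11, spinMatrix_12, spinMatrix_13, spinMatrix_20, spinMatrix_21,
      spinMatrix_22, spinMatrix_23, spinMatrix_30, spinMatrix_31, spinMatrix_32,
      spinMatrix_33] <;>
      apply Complex.ext <;>
      simp only [Complex.star_def, Complex.conj_re, Complex.conj_im, Complex.neg_re,
        Complex.neg_im, half_re, half_im] <;>
      ring
  · rw [Matrix.trace, Fin.sum_univ_four]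
    apply Complex.ext <;>
      simp only [Matrix.diag_apply, spinMatrix_00, spinMatrix_01, spinMatrix_02, spinMatrix_03, spinMatrix_10,
      spinMatrix_11, spinMatrix_12, spinMatrix_13, spinMatrix_20, spinMatrix_21,
      spinMatrix_22, spinMatrix_23, spinMatrix_30, spinMatrix_31, spinMatrix_32,
      spinMatrix_33, Complex.add_re,
        Complex.add_im, half_re, half_im, Complex.zero_re, Complex.zero_im] <;>
      ring

theorem vectorMatrix_mem (A : Matrix (Fin 4) (Fin 4) ℂ) : vectorMatrix A ∈ so6 := by
  rw [LieAlgebra.Orthogonal.mem_so, vectorMatrix, transpose_sub, transpose_transpose, neg_sub]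

theorem spinMatrix_lie (X Y : so6) :
    spinMatrix (X.1 * Y.1 - Y.1 * X.1) =
      spinMatrix X.1 * spinMatrix Y.1 - spinMatrix Y.1 * spinMatrix X.1 := by
  have hx := so6_apply X
  have hy := so6_apply Y
  have kx := so6_diag X
  have ky := so6_diag Y
  generalize X.1 = x at *
  generalize Y.1 = y at *
  have x10 := hx 0 1
  have y10 := hy 0 1
  have x20 := hx 0 2
  have y20 := hy 0 2
  have x30 := hx 0 3
  have y30 := hy 0 3
  have x40 := hx 0 4
  have y40 := hy 0 4
  have x50 := hx 0 5
  have y50 := hy 0 5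
  have x21 := hx 1 2
  have y21 := hy 1 2
  have x31 := hx 1 3
  have y31 := hy 1 3
  have x41 := hx 1 4
  have y41 := hy 1 4
  have x51 := hx 1 5
  have y51 := hy 1 5
  have x32 := hx 2 3
  have y32 := hy 2 3
  have x42 := hx 2 4
  have y42 := hy 2 4
  have x52 := hx 2 5
  have y52 := hy 2 5
  have x43 := hx 3 4
  have y43 := hy 3 4
  have x53 := hx 3 5
  have y53 := hy 3 5
  have x54 := hx 4 5
  have y54 := hy 4 5
  clear hx hy
  have hz : ∀ a b, (x * y - y * x) a b =
      x a 0 * y 0 b + x a 1 * y 1 b + x a 2 * y 2 b + x a 3 * y 3 b + x a 4 * y 4 b + x a 5 * y 5 b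
      - (y a 0 * x 0 b + y a 1 * x 1 b + y a 2 * x 2 b + y a 3 * x 3 b + y a 4 * x 4 b
        + y a 5 * x 5 b) := fun a b => by
    rw [Matrix.sub_apply, Matrix.mul_apply, Matrix.mul_apply, Fin.sum_univ_six, Fin.sum_univ_six]
  ext i j
  rw [Matrix.sub_apply, Matrix.mul_apply, Matrix.mul_apply, Fin.sum_univ_four, Fin.sum_univ_four]
  fin_cases i <;> fin_cases j <;>
    dsimp only [Fin.mk_zero, Fin.mk_one, Fin.reduceFinMk, Fin.zero_eta, Fin.isValue] <;>
    simp only [spinMatrix_00, spinMatrix_01, spinMatrix_02, spinMatrix_03, spinMatrix_10,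
      spinMatrix_11, spinMatrix_12, spinMatrix_13, spinMatrix_20, spinMatrix_21,
      spinMatrix_22, spinMatrix_23, spinMatrix_30, spinMatrix_31, spinMatrix_32,
      spinMatrix_33] <;>
    apply Complex.ext <;>
    simp only [Complex.add_re, Complex.add_im, Complex.sub_re, Complex.sub_im, Complex.mul_re,
      Complex.mul_im, half_re, half_im, hz, kx, ky,
      x10, y10, x20, y20, x30, y30, x40, y40, x50, y50, x21, y21, x31, y31, x41, y41, x51,
      y51, x32, y32, x42, y42, x52, y52, x43, y43, x53, y53, x54, y54] <;>
    ring

theorem vectorMatrix_spinMatrix (X : so6) : vectorMatrix (spinMatrix X.1) = X.1 := by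
  have hx := so6_apply X
  have kx := so6_diag X
  generalize X.1 = x at *
  have x10 := hx 0 1
  have x20 := hx 0 2
  have x30 := hx 0 3
  have x40 := hx 0 4
  have x50 := hx 0 5
  have x21 := hx 1 2
  have x31 := hx 1 3
  have x41 := hx 1 4
  have x51 := hx 1 5
  have x32 := hx 2 3
  have x42 := hx 2 4
  have x52 := hx 2 5
  have x43 := hx 3 4
  have x53 := hx 3 5
  have x54 := hx 4 5
  clear hx
  ext a b
  rw [vectorMatrix_apply]
  fin_cases a <;> fin_cases b <;>
    dsimp only [Fin.mk_zero, Fin.mk_one, Fin.reduceFinMk, Fin.zero_eta, Fin.isValue] <;>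
    simp only [upperMatrix_00, upperMatrix_01, upperMatrix_02, upperMatrix_03, upperMatrix_04,
      upperMatrix_05, upperMatrix_10, upperMatrix_11, upperMatrix_12, upperMatrix_13,
      upperMatrix_14, upperMatrix_15, upperMatrix_20, upperMatrix_21, upperMatrix_22,
      upperMatrix_23, upperMatrix_24, upperMatrix_25, upperMatrix_30, upperMatrix_31,
      upperMatrix_32, upperMatrix_33, upperMatrix_34, upperMatrix_35, upperMatrix_40,
      upperMatrix_41, upperMatrix_42, upperMatrix_43, upperMatrix_44, upperMatrix_45,
      upperMatrix_50, upperMatrix_51, upperMatrix_52, upperMatrix_53, upperMatrix_54,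
      upperMatrix_55,
      spinMatrix_00, spinMatrix_01, spinMatrix_02, spinMatrix_03, spinMatrix_10,
      spinMatrix_11, spinMatrix_12, spinMatrix_13, spinMatrix_20, spinMatrix_21,
      spinMatrix_22, spinMatrix_23, spinMatrix_30, spinMatrix_31, spinMatrix_32,
      spinMatrix_33,
      half_re, half_im, kx, x10, x20, x30, x40, x50, x21, x31, x41, x51, x32, x42, x52, x43, x53, x54] <;>
    ring

theorem spinMatrix_vectorMatrix (A : su4) : spinMatrix (vectorMatrix A.1) = A.1 := by
  have h : ∀ i j, star (A.1 j i) = -A.1 i j := fun i j => congrFun (congrFun A.2.1 i) j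
  have hre : ∀ i j, (A.1 j i).re = -(A.1 i j).re := fun i j => by
    simpa using congrArg Complex.re (h i j)
  have him : ∀ i j, (A.1 j i).im = (A.1 i j).im := fun i j => by
    simpa using congrArg Complex.im (h i j)
  have ht : (A.1 0 0).im + (A.1 1 1).im + (A.1 2 2).im + (A.1 3 3).im = 0 := by
    have := congrArg Complex.im A.2.2
    simpa [Matrix.trace, Fin.sum_univ_four] using this
  have hd : ∀ i, (A.1 i i).re = 0 := fun i => by linarith [hre i i]
  generalize A.1 = x at *
  have r10 := hre 0 1
  have i10 := him 0 1
  have r20 := hre 0 2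
  have i20 := him 0 2
  have r30 := hre 0 3
  have i30 := him 0 3
  have r21 := hre 1 2
  have i21 := him 1 2
  have r31 := hre 1 3
  have i31 := him 1 3
  have r32 := hre 2 3
  have i32 := him 2 3
  ext i j
  fin_cases i <;> fin_cases j <;>
    dsimp only [Fin.mk_zero, Fin.mk_one, Fin.reduceFinMk, Fin.zero_eta, Fin.isValue] <;>
    simp only [spinMatrix_00, spinMatrix_01, spinMatrix_02, spinMatrix_03, spinMatrix_10,
      spinMatrix_11, spinMatrix_12, spinMatrix_13, spinMatrix_20, spinMatrix_21,
      spinMatrix_22, spinMatrix_23, spinMatrix_30, spinMatrix_31, spinMatrix_32,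
      spinMatrix_33] <;>
    apply Complex.ext <;>
    simp only [half_re, half_im, vectorMatrix_apply,
      upperMatrix_00, upperMatrix_01, upperMatrix_02, upperMatrix_03, upperMatrix_04,
      upperMatrix_05, upperMatrix_10, upperMatrix_11, upperMatrix_12, upperMatrix_13,
      upperMatrix_14, upperMatrix_15, upperMatrix_20, upperMatrix_21, upperMatrix_22,
      upperMatrix_23, upperMatrix_24, upperMatrix_25, upperMatrix_30, upperMatrix_31,
      upperMatrix_32, upperMatrix_33, upperMatrix_34, upperMatrix_35, upperMatrix_40,
      upperMatrix_41, upperMatrix_42, upperMatrix_43, upperMatrix_44, upperMatrix_45,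
      upperMatrix_50, upperMatrix_51, upperMatrix_52, upperMatrix_53, upperMatrix_54,
      upperMatrix_55,
      hd, r10, i10, r20, i20, r30, i30, r21, i21, r31, i31, r32, i32] <;>
    linarith

/-- The isomorphism of real Lie algebras `so(6) ≅ su(4)`. -/
def spinEquiv : so6 ≃ₗ⁅ℝ⁆ su4 where
  toFun X := ⟨spinMatrix X.1, spinMatrix_mem X.1⟩
  invFun A := ⟨vectorMatrix A.1, vectorMatrix_mem A.1⟩
  map_add' X Y := Subtype.ext (spinMatrix_add X.1 Y.1)
  map_smul' c X := Subtype.ext (spinMatrix_smul c X.1)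
  map_lie' {X Y} := Subtype.ext (spinMatrix_lie X Y)
  left_inv X := Subtype.ext (vectorMatrix_spinMatrix X)
  right_inv A := Subtype.ext (spinMatrix_vectorMatrix A)

/-! ### The joint algebras -/

/-- The infinitesimal rotation `E a b - E b a` of `ℝ⁶` in the coordinate plane `(a, b)`. -/
def rot (a b : Fin 6) : so6 :=
  ⟨single a b 1 - single b a 1, by
    rw [LieAlgebra.Orthogonal.mem_so, transpose_sub, transpose_single, transpose_single, neg_sub]⟩

/-- The rotation generator `J₁` of the six-dimensional subalgebra of `su(4)`. -/
def uJ₁ : su4 :=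
  ⟨(1 / 2 : ℝ) • !![0, 1, 0, 0; -1, 0, 0, 0; 0, 0, 0, 1; 0, 0, -1, 0], by
    rw [mem_su4]
    refine ⟨?_, by simp [Matrix.trace, Fin.sum_univ_four]⟩
    ext i j
    fin_cases i <;> fin_cases j <;> simp⟩

/-- The rotation generator `J₂`. -/
def uJ₂ : su4 :=
  ⟨(1 / 2 : ℝ) • !![0, Complex.I, 0, 0; Complex.I, 0, 0, 0;
      0, 0, 0, Complex.I; 0, 0, Complex.I, 0], by
    rw [mem_su4]
    refine ⟨?_, by simp [Matrix.trace, Fin.sum_univ_four]⟩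
    ext i j
    fin_cases i <;> fin_cases j <;> simp⟩

/-- The rotation generator `J₃`. -/
def uJ₃ : su4 :=
  ⟨(1 / 2 : ℝ) • !![Complex.I, 0, 0, 0; 0, -Complex.I, 0, 0;
      0, 0, Complex.I, 0; 0, 0, 0, -Complex.I], by
    rw [mem_su4]
    refine ⟨?_, by simp [Matrix.trace, Fin.sum_univ_four]⟩
    ext i j
    fin_cases i <;> fin_cases j <;> simp⟩

/-- The boost generator `K₁`. -/
def uK₁ : su4 :=
  ⟨(1 / 2 : ℝ) • !![0, 0, 0, Complex.I; 0, 0, -Complex.I, 0;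
      0, -Complex.I, 0, 0; Complex.I, 0, 0, 0], by
    rw [mem_su4]
    refine ⟨?_, by simp [Matrix.trace, Fin.sum_univ_four]⟩
    ext i j
    fin_cases i <;> fin_cases j <;> simp⟩

/-- The boost generator `K₂`. -/
def uK₂ : su4 :=
  ⟨(1 / 2 : ℝ) • !![0, 0, 0, 1; 0, 0, 1, 0; 0, -1, 0, 0; -1, 0, 0, 0], by
    rw [mem_su4]
    refine ⟨?_, by simp [Matrix.trace, Fin.sum_univ_four]⟩
    ext i j
    fin_cases i <;> fin_cases j <;> simp⟩

/-- The boost generator `K₃`. -/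
def uK₃ : su4 :=
  ⟨(1 / 2 : ℝ) • !![0, 0, -1, 0; 0, 0, 0, 1; 1, 0, 0, 0; 0, -1, 0, 0], by
    rw [mem_su4]
    refine ⟨?_, by simp [Matrix.trace, Fin.sum_univ_four]⟩
    ext i j
    fin_cases i <;> fin_cases j <;> simp⟩

/-- The joint algebra in `su(4)`, given by its basis `J₁, J₂, J₃, K₁, K₂, K₃`. -/
def unitaryJointAlgebra : LieSubalgebra ℝ su4 :=
  LieSubalgebra.lieSpan ℝ su4 {uJ₁, uJ₂, uJ₃, uK₁, uK₂, uK₃}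

/-- The joint algebra in `so(6)` that corresponds to `unitaryJointAlgebra` under
`so(6) ≅ su(4)`. -/
def jointAlgebra : LieSubalgebra ℝ so6 :=
  unitaryJointAlgebra.comap spinEquiv.toLieHom

/-- The subalgebra of `so(6)` generated by the diagonal rotations and the common boost `K₃` of the
two algebras with bases
`J₁ = rot 1 2, J₂ = rot 0 2, J₃ = rot 0 1, K₁ = rot 0 3, K₂ = rot 1 3, K₃ = rot 2 3` and
`J₁ = rot 4 3, J₂ = rot 5 3, J₃ = rot 5 4, K₁ = rot 2 5, K₂ = rot 2 4, K₃ = rot 2 3`,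
which have the same structure constants. -/
def generatedJointAlgebra : LieSubalgebra ℝ so6 :=
  LieSubalgebra.lieSpan ℝ so6
    {rot 1 2 + rot 4 3, rot 0 2 + rot 5 3, rot 0 1 + rot 5 4, rot 2 3}

/-! ### Connected subgroups and covering epimorphisms -/

/-- The connected Lie subgroup of `SO(6)` with Lie algebra `h`: the subgroup generated by
`exp X`, `X ∈ h`. -/
def connectedSubgroupSO (h : LieSubalgebra ℝ so6) : Subgroup (specialOrthogonalGroup (Fin 6) ℝ) :=
  Subgroup.closure {g | ∃ X ∈ h, g.1 = NormedSpace.exp X.1}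

/-- The connected Lie subgroup of `SU(4)` with Lie algebra `k`: the subgroup generated by
`exp X`, `X ∈ k`. -/
def connectedSubgroupSU (k : LieSubalgebra ℝ su4) : Subgroup (specialUnitaryGroup (Fin 4) ℂ) :=
  Subgroup.closure {u | ∃ X ∈ k, u.1 = NormedSpace.exp X.1}

/-- `Ξ` is a twofold covering epimorphism of (matrix) Lie groups: a surjective group homomorphism,
smooth (it is the restriction of a smooth map between the spaces of matrices), which is a covering
map whose fibres all have two elements. -/
structure IsTwofoldCoveringEpimorphism {UG : Subgroup (specialUnitaryGroup (Fin 4) ℂ)}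
    {G : Subgroup (specialOrthogonalGroup (Fin 6) ℝ)} (Ξ : UG →* G) : Prop where
  smooth : ∃ F : (Fin 4 → Fin 4 → ℂ) → (Fin 6 → Fin 6 → ℝ), ContDiff ℝ ∞ F ∧
    ∀ u : UG, F (fun i j => u.1.1 i j) = fun a b => (Ξ u).1.1 a b
  surjective : Function.Surjective Ξ
  isCoveringMap : IsCoveringMap Ξ
  fiber : ∀ g : G, Nat.card (Ξ ⁻¹' {g}) = 2

end Superspin

end

/-! The group `SU(4)` acts on complex skew-symmetric 4×4 matrices by `B ↦ u B uᵀ`. This action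
preserves a real six-dimensional subspace, the image of `skewOf`, and acts there as the vector
representation, whose differential is the inverse of `spinEquiv`. The relation `Covers u g` says
that `u` acts on this subspace as `g` acts on `ℝ⁶`. It is multiplicative, it determines `g` from
`u`, and it holds for the pairs `exp φ(X)`, `exp X` (`covers_exp`). Hence it defines a surjective
homomorphism `coveringHom` from `UG` to `G` for every subalgebra `h`, given by a real polynomial map
of matrices.

Only `±1` cover the identity (`Covers.eq_one_or_eq_neg_one`), and `-1 = exp (2π K₃)` lies in `UG`
because both algebras contain `R₂₃` (`negOne_mem`). If `UG` is closed, it is compact. The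
homomorphism is then a quotient map with a kernel of two elements, thus a twofold covering, and `G`
is closed as a compact image.

What remains is that `UG` is closed, and in each case this follows because `UG` is cut out by closed
conditions. The first algebra is `so(4)`, the stabilizer of the last two coordinate vectors. The
elements of `SU(4)` that fix both vectors are pairs of unit quaternions, and each quaternion is an
exponential by its polar form (`mem_connectedSubgroupSU_of_fixes`). The second algebra is `u(3)`,
the centralizer of a complex structure `J`. An element of `SU(4)` commuting with `φ(J)` has a
logarithm commuting with `φ(J)`, whose trace can be made zero
(`mem_connectedSubgroupSU_unitaryAlgebra_iff`). -/

noncomputable section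

attribute [local instance 100] LieRing.ofAssociativeRing

namespace Superspin

/-! ### Exponentials of matrices -/

section exponential

variable {n : Type*} [Fintype n] [DecidableEq n]

open scoped Matrix.Norms.L2Operator in
/-- Euler's formula for a square root `N` of `-1`. -/
theorem exp_smul_of_mul_self_eq_neg_one {N : Matrix n n ℂ} (hN : N * N = -1) (θ : ℝ) :
    NormedSpace.exp (θ • N) = Real.cos θ • (1 : Matrix n n ℂ) + Real.sin θ • N := by
  let f : ℂ →ₐ[ℝ] Matrix n n ℂ := Complex.liftAux N hN
  have hf : Continuous f := f.toLinearMap.continuous_of_finiteDimensional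
  have h := NormedSpace.map_exp (f : ℂ →+* Matrix n n ℂ) hf (θ * Complex.I)
  rw [← Complex.exp_eq_exp_ℂ] at h
  have h1 : f (θ * Complex.I) = θ • N := by simp [f, Complex.liftAux_apply]
  have h2 : f (Complex.exp (θ * Complex.I)) =
      Real.cos θ • (1 : Matrix n n ℂ) + Real.sin θ • N := by
    rw [Complex.liftAux_apply, Complex.exp_ofReal_mul_I_re, Complex.exp_ofReal_mul_I_im,
      Algebra.algebraMap_eq_smul_one]
  simp only [RingHom.coe_coe] at h
  rw [← h1, ← h2, ← h]

/-- The matrix `-iA` is Hermitian, so `A` is unitarily diagonalizable and the formula reduces to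
diagonal matrices. -/
theorem det_exp_of_conjTranspose_eq_neg {A : Matrix n n ℂ} (hA : Aᴴ = -A) :
    (NormedSpace.exp A).det = Complex.exp A.trace := by
  have hH : (-Complex.I • A).IsHermitian := by
    rw [IsHermitian, conjTranspose_smul, hA]; simp
  have hs := hH.spectral_theorem
  set D : n → ℂ := fun i => Complex.I * (hH.eigenvalues i : ℂ) with hD
  set U : Matrix n n ℂ := hH.eigenvectorUnitary.1 with hU
  have hUU : U * star U = 1 := Unitary.coe_mul_star_self _
  have hA' : A = U * diagonal D * U⁻¹ := by
    have hinv : U⁻¹ = star U := inv_eq_right_inv hUU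
    have h1 : A = Complex.I • (-Complex.I • A) := by
      rw [smul_smul]; simp
    rw [h1, hs, hinv, Unitary.conjStarAlgAut_apply]
    have h2 : diagonal D = Complex.I • diagonal (RCLike.ofReal ∘ hH.eigenvalues : n → ℂ) := by
      rw [← diagonal_smul]; rfl
    rw [h2, mul_smul_comm, smul_mul_assoc]
  have hUunit : IsUnit U := (isUnit_iff_isUnit_det _).2 (isUnit_det_of_right_inverse hUU)
  have hUdet := (isUnit_iff_isUnit_det _).1 hUunit
  rw [hA', exp_conj _ _ hUunit, det_conj hUunit, exp_diagonal, det_diagonal,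
    trace_mul_cycle, nonsing_inv_mul _ hUdet, one_mul, trace_diagonal, Complex.exp_sum]
  refine Finset.prod_congr rfl fun i _ => ?_
  rw [Pi.coe_exp, Complex.exp_eq_exp_ℂ]

theorem exp_mem_unitaryGroup {A : Matrix n n ℂ} (hA : Aᴴ = -A) :
    NormedSpace.exp A ∈ unitaryGroup n ℂ := by
  rw [mem_unitaryGroup_iff, star_eq_conjTranspose, ← exp_conjTranspose, hA,
    ← exp_add_of_commute _ _ ((Commute.refl A).neg_right)]
  simp

theorem exp_mem_specialUnitaryGroup {A : Matrix n n ℂ} (hA : Aᴴ = -A) (hA' : A.trace = 0) :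
    NormedSpace.exp A ∈ specialUnitaryGroup n ℂ :=
  mem_specialUnitaryGroup_iff.2 ⟨exp_mem_unitaryGroup hA, by
    rw [det_exp_of_conjTranspose_eq_neg hA, hA', Complex.exp_zero]⟩

theorem exp_mem_specialOrthogonalGroup {X : Matrix n n ℝ} (hX : Xᵀ = -X) :
    NormedSpace.exp X ∈ specialOrthogonalGroup n ℝ := by
  have h : ∀ Y : Matrix n n ℝ, Yᵀ = -Y →
      NormedSpace.exp Y * (NormedSpace.exp Y)ᵀ = 1 := fun Y hY => by
    rw [← exp_transpose, hY, ← exp_add_of_commute _ _ ((Commute.refl Y).neg_right)]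
    simp
  refine mem_specialOrthogonalGroup_iff.2 ⟨(mem_orthogonalGroup_iff _ _).2 (h X hX), ?_⟩
  -- The determinant of `exp X` is the square of that of `exp (X/2)`, and the latter is `±1` by
  -- orthogonality.
  have h1 : NormedSpace.exp X =
      NormedSpace.exp ((1 / 2 : ℝ) • X) * NormedSpace.exp ((1 / 2 : ℝ) • X) := by
    rw [← exp_add_of_commute _ _ (Commute.refl _), ← add_smul]
    norm_num
  have h2 := congrArg det (h ((1 / 2 : ℝ) • X) (by rw [transpose_smul, hX, smul_neg]))
  rw [det_mul, det_transpose, det_one] at h2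
  rw [h1, det_mul, h2]

open scoped Matrix.Norms.L2Operator in
/-- A unitary matrix has a skew-Hermitian logarithm that commutes with everything that commutes
with the matrix. -/
theorem exists_log_of_mem_unitaryGroup {u : Matrix n n ℂ} (hu : u ∈ unitaryGroup n ℂ) :
    ∃ A : Matrix n n ℂ, Aᴴ = -A ∧ NormedSpace.exp A = u ∧ ∀ P, Commute P u → Commute P A := by
  have hn : IsStarNormal u := ⟨by
    rw [Commute, SemiconjBy, (Unitary.mem_iff.1 hu).1, (Unitary.mem_iff.1 hu).2]⟩
  have hfin : (spectrum ℂ u).Finite := Matrix.finite_spectrum u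
  -- The argument is discontinuous on the circle, but on a finite spectrum every function is
  -- continuous, so the functional calculus applies.
  have hc : ∀ g : ℂ → ℂ, ContinuousOn g (spectrum ℂ u) := fun g => hfin.continuousOn g
  refine ⟨cfc (fun z : ℂ => (z.arg : ℂ) * Complex.I) u, ?_, ?_, ?_⟩
  · rw [← star_eq_conjTranspose, ← cfc_star, ← cfc_neg]
    congr 1
    ext z
    simp
  · rw [← CFC.complex_exp_eq_normedSpace_exp (cfc_predicate _ _),
      ← cfc_comp' _ _ _ (hfin.image _ |>.continuousOn _) (hc _)]
    conv_rhs => rw [← cfc_id ℂ u]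
    refine cfc_congr fun z hz => ?_
    have hz1 : ‖z‖ = 1 := by
      simpa using spectrum.subset_circle_of_unitary hu hz
    have := Complex.norm_mul_exp_arg_mul_I z
    rw [hz1] at this
    simpa using this
  · intro P hP
    -- The functional calculus of a normal element involves its adjoint; here the adjoint is the
    -- inverse of `u`.
    have hP' : Commute P (star u) := by
      have h1 := (Unitary.mem_iff.1 hu).1
      have h2 := (Unitary.mem_iff.1 hu).2
      calc P * star u = star u * u * P * star u := by rw [h1, one_mul]
        _ = star u * (u * P) * star u := by simp only [mul_assoc]
        _ = star u * (P * u) * star u := by rw [hP.eq]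
        _ = star u * P * (u * star u) := by simp only [mul_assoc]
        _ = star u * P := by rw [h2, mul_one]
    exact (Commute.cfc hP.symm hP'.symm _).symm

end exponential

/-! ### The vector representation of `SU(4)` -/

/-- The skew-symmetric matrix `(∑ x a • s a) C`, where `C = σ₂ ⊗ 1`. -/
def skewOf (x : Fin 6 → ℝ) : Matrix (Fin 4) (Fin 4) ℂ :=
  !![0, ⟨x 3, -x 4⟩, ⟨-x 1, -x 0⟩, ⟨-x 2, x 5⟩;
    ⟨-x 3, x 4⟩, 0, ⟨-x 2, -x 5⟩, ⟨x 1, -x 0⟩;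
    ⟨x 1, x 0⟩, ⟨x 2, x 5⟩, 0, ⟨x 3, x 4⟩;
    ⟨x 2, -x 5⟩, ⟨-x 1, x 0⟩, ⟨-x 3, -x 4⟩, 0]

section entries

variable (x : Fin 6 → ℝ)

theorem skewOf_00 : skewOf x 0 0 = 0 := rfl
theorem skewOf_01 : skewOf x 0 1 = ⟨x 3, -x 4⟩ := rfl
theorem skewOf_02 : skewOf x 0 2 = ⟨-x 1, -x 0⟩ := rfl
theorem skewOf_03 : skewOf x 0 3 = ⟨-x 2, x 5⟩ := rfl
theorem skewOf_10 : skewOf x 1 0 = ⟨-x 3, x 4⟩ := rfl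
theorem skewOf_11 : skewOf x 1 1 = 0 := rfl
theorem skewOf_12 : skewOf x 1 2 = ⟨-x 2, -x 5⟩ := rfl
theorem skewOf_13 : skewOf x 1 3 = ⟨x 1, -x 0⟩ := rfl
theorem skewOf_20 : skewOf x 2 0 = ⟨x 1, x 0⟩ := rfl
theorem skewOf_21 : skewOf x 2 1 = ⟨x 2, x 5⟩ := rfl
theorem skewOf_22 : skewOf x 2 2 = 0 := rfl
theorem skewOf_23 : skewOf x 2 3 = ⟨x 3, x 4⟩ := rfl
theorem skewOf_30 : skewOf x 3 0 = ⟨x 2, -x 5⟩ := rfl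
theorem skewOf_31 : skewOf x 3 1 = ⟨-x 1, x 0⟩ := rfl
theorem skewOf_32 : skewOf x 3 2 = ⟨-x 3, -x 4⟩ := rfl
theorem skewOf_33 : skewOf x 3 3 = 0 := rfl

end entries

/-- The left inverse of `skewOf`. -/
def ofSkew (B : Matrix (Fin 4) (Fin 4) ℂ) : Fin 6 → ℝ :=
  ![-(B 0 2).im, -(B 0 2).re, -(B 0 3).re, (B 0 1).re, -(B 0 1).im, (B 0 3).im]

theorem ofSkew_skewOf (x : Fin 6 → ℝ) : ofSkew (skewOf x) = x := by
  ext a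
  fin_cases a <;> simp [ofSkew, skewOf]

theorem skewOf_injective : Function.Injective skewOf :=
  Function.LeftInverse.injective ofSkew_skewOf

theorem skewOf_add (x y : Fin 6 → ℝ) : skewOf (x + y) = skewOf x + skewOf y := by
  ext i j
  fin_cases i <;> fin_cases j <;> simp [skewOf, Complex.ext_iff, add_comm]

theorem skewOf_smul (c : ℝ) (x : Fin 6 → ℝ) : skewOf (c • x) = c • skewOf x := by
  ext i j
  fin_cases i <;> fin_cases j <;> simp [skewOf, Complex.ext_iff]

/-- `skewOf` as a linear map. -/
def skewOfₗ : (Fin 6 → ℝ) →ₗ[ℝ] Matrix (Fin 4) (Fin 4) ℂ where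
  toFun := skewOf
  map_add' := skewOf_add
  map_smul' := skewOf_smul

/-- The infinitesimal form of `Covers`: the right side is the derivative of `B ↦ u B uᵀ` at the
identity in the direction `spinMatrix X`. Both sides are bilinear in `X` and `x`, and the entries
are compared after expressing `X` by its entries above the diagonal. -/
theorem skewOf_mulVec (X : so6) (x : Fin 6 → ℝ) :
    skewOf (X.1 *ᵥ x) = spinMatrix X.1 * skewOf x + skewOf x * (spinMatrix X.1)ᵀ := by
  have hx := so6_apply X
  have kx := so6_diag X
  generalize X.1 = y at *
  have x10 := hx 0 1
  have x20 := hx 0 2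
  have x30 := hx 0 3
  have x40 := hx 0 4
  have x50 := hx 0 5
  have x21 := hx 1 2
  have x31 := hx 1 3
  have x41 := hx 1 4
  have x51 := hx 1 5
  have x32 := hx 2 3
  have x42 := hx 2 4
  have x52 := hx 2 5
  have x43 := hx 3 4
  have x53 := hx 3 5
  have x54 := hx 4 5
  clear hx
  have hz : ∀ a, (y *ᵥ x) a = y a 0 * x 0 + y a 1 * x 1 + y a 2 * x 2 + y a 3 * x 3 + y a 4 * x 4
      + y a 5 * x 5 := fun a => by simp [mulVec, dotProduct, Fin.sum_univ_six]
  ext i j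
  rw [Matrix.add_apply, Matrix.mul_apply, Matrix.mul_apply, Fin.sum_univ_four, Fin.sum_univ_four]
  simp only [Matrix.transpose_apply]
  fin_cases i <;> fin_cases j <;>
    dsimp only [Fin.mk_zero, Fin.mk_one, Fin.reduceFinMk, Fin.zero_eta, Fin.isValue] <;>
    simp only [spinMatrix_00, spinMatrix_01, spinMatrix_02, spinMatrix_03, spinMatrix_10,
      spinMatrix_11, spinMatrix_12, spinMatrix_13, spinMatrix_20, spinMatrix_21,
      spinMatrix_22, spinMatrix_23, spinMatrix_30, spinMatrix_31, spinMatrix_32,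
      spinMatrix_33,
      skewOf_00, skewOf_01, skewOf_02, skewOf_03, skewOf_10, skewOf_11, skewOf_12, skewOf_13,
      skewOf_20, skewOf_21, skewOf_22, skewOf_23, skewOf_30, skewOf_31, skewOf_32,
      skewOf_33] <;>
    apply Complex.ext <;>
    simp only [Complex.add_re, Complex.add_im, Complex.mul_re, Complex.mul_im, Complex.zero_re,
      Complex.zero_im, half_re, half_im, hz, kx,
      x10, x20, x30, x40, x50, x21, x31, x41, x51, x32, x42, x52, x43, x53, x54] <;>
    ring

/-- `u` acts on the skew-symmetric matrices `skewOf x` as `g` acts on the vectors `x`. -/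
def Covers (u : Matrix (Fin 4) (Fin 4) ℂ) (g : Matrix (Fin 6) (Fin 6) ℝ) : Prop :=
  ∀ x : Fin 6 → ℝ, u * skewOf x * uᵀ = skewOf (g *ᵥ x)

theorem Covers.mul {u v : Matrix (Fin 4) (Fin 4) ℂ} {g k : Matrix (Fin 6) (Fin 6) ℝ}
    (hu : Covers u g) (hv : Covers v k) : Covers (u * v) (g * k) := fun x => by
  rw [← mulVec_mulVec, ← hu, ← hv, transpose_mul]
  simp only [mul_assoc]

theorem Covers.one : Covers 1 1 := fun x => by simp

theorem Covers.neg {u : Matrix (Fin 4) (Fin 4) ℂ} {g : Matrix (Fin 6) (Fin 6) ℝ}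
    (hu : Covers u g) : Covers (-u) g := fun x => by
  rw [← hu, transpose_neg]
  simp

theorem Covers.unique {u : Matrix (Fin 4) (Fin 4) ℂ} {g k : Matrix (Fin 6) (Fin 6) ℝ}
    (hg : Covers u g) (hk : Covers u k) : g = k :=
  Matrix.ext_of_mulVec_single fun _ =>
    skewOf_injective ((hg _).symm.trans (hk _))

/-- The smooth map between spaces of matrices that gives the vector representation. -/
def vectorRep (u : Matrix (Fin 4) (Fin 4) ℂ) : Matrix (Fin 6) (Fin 6) ℝ :=
  Matrix.of fun a b => ofSkew (u * skewOf (Pi.single b 1) * uᵀ) a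

theorem Covers.vectorRep_eq {u : Matrix (Fin 4) (Fin 4) ℂ} {g : Matrix (Fin 6) (Fin 6) ℝ}
    (hu : Covers u g) : vectorRep u = g := by
  ext a b
  rw [vectorRep, of_apply, hu, ofSkew_skewOf, mulVec_single_one, col_apply]

theorem contDiff_vectorRep :
    ContDiff ℝ ∞ fun (u : Fin 4 → Fin 4 → ℂ) (a b : Fin 6) => vectorRep (Matrix.of u) a b := by
  refine contDiff_pi.2 fun a => contDiff_pi.2 fun b => ?_
  have h : ∀ i j, ContDiff ℝ ∞ fun u : Fin 4 → Fin 4 → ℂ =>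
      (Matrix.of u * skewOf (Pi.single b 1) * (Matrix.of u)ᵀ) i j := fun i j => by
    simp only [mul_apply, transpose_apply, of_apply]
    fun_prop
  have hre : ∀ i j, ContDiff ℝ ∞ fun u : Fin 4 → Fin 4 → ℂ =>
      ((Matrix.of u * skewOf (Pi.single b 1) * (Matrix.of u)ᵀ) i j).re := fun i j =>
    Complex.reCLM.contDiff.comp (h i j)
  have him : ∀ i j, ContDiff ℝ ∞ fun u : Fin 4 → Fin 4 → ℂ =>
      ((Matrix.of u * skewOf (Pi.single b 1) * (Matrix.of u)ᵀ) i j).im := fun i j =>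
    Complex.imCLM.contDiff.comp (h i j)
  fin_cases a
  exacts [(him 0 2).neg, (hre 0 2).neg, (hre 0 3).neg, hre 0 1, (him 0 1).neg, him 0 3]

-- With `A = spinMatrix X`, the curve `exp(-tA) · skewOf (exp(tX) x) · exp(-tAᵀ)` has zero
-- derivative by `skewOf_mulVec`. Its values at `t = 1` and `t = 0` therefore agree.
open scoped Matrix.Norms.L2Operator in
theorem covers_exp (X : so6) :
    Covers (NormedSpace.exp (spinMatrix X.1)) (NormedSpace.exp X.1) := by
  intro x
  set A := spinMatrix X.1 with hA
  let L : Matrix (Fin 6) (Fin 6) ℝ →ₗ[ℝ] Matrix (Fin 4) (Fin 4) ℂ :=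
    { toFun := fun Y => skewOfₗ (Y *ᵥ x)
      map_add' := fun Y Z => by rw [add_mulVec, map_add]
      map_smul' := fun c Y => by rw [smul_mulVec, map_smul]; rfl }
  let L' := LinearMap.toContinuousLinearMap L
  have hL : ∀ Y, L' Y = skewOf (Y *ᵥ x) := fun Y => rfl
  let f : ℝ → Matrix (Fin 4) (Fin 4) ℂ := fun t =>
    NormedSpace.exp (t • -A) * L' (NormedSpace.exp (t • X.1)) * NormedSpace.exp (t • -Aᵀ)
  have hf : ∀ t, HasDerivAt f 0 t := fun t => by
    have h1 := hasDerivAt_exp_smul_const (𝕂 := ℝ) (-A) t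
    have h2 := L'.hasFDerivAt.comp_hasDerivAt t (hasDerivAt_exp_smul_const' (𝕂 := ℝ) X.1 t)
    have h3 := hasDerivAt_exp_smul_const' (𝕂 := ℝ) (-Aᵀ) t
    refine ((h1.mul h2).mul h3).congr_deriv ?_
    rw [Pi.mul_apply, hL, ← mulVec_mulVec, skewOf_mulVec, ← hA, Function.comp_apply, hL]
    noncomm_ring
  have hconst := is_const_of_deriv_eq_zero (fun t => (hf t).differentiableAt)
    (fun t => (hf t).deriv) 1 0
  simp only [f, one_smul, zero_smul, NormedSpace.exp_zero, one_mul, mul_one, hL, one_mulVec]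
    at hconst
  have e1 : NormedSpace.exp A * NormedSpace.exp (-A) = 1 := by
    rw [← Matrix.exp_add_of_commute _ _ ((Commute.refl A).neg_right)]; simp
  have e2 : NormedSpace.exp (-Aᵀ) * NormedSpace.exp Aᵀ = 1 := by
    rw [← Matrix.exp_add_of_commute _ _ ((Commute.refl Aᵀ).neg_left)]; simp
  rw [← hconst, ← exp_transpose]
  calc _ = (NormedSpace.exp A * NormedSpace.exp (-A)) * skewOf (NormedSpace.exp X.1 *ᵥ x) *
        (NormedSpace.exp (-Aᵀ) * NormedSpace.exp Aᵀ) := by simp only [mul_assoc]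
    _ = _ := by rw [e1, e2, one_mul, mul_one]

/-- Unitarity makes the entrywise conjugate of `u` the inverse of `uᵀ`. A condition quadratic in `u`
thus becomes real-linear in `u`. -/
theorem mul_skewOf_eq {u : Matrix (Fin 4) (Fin 4) ℂ} (hu : u ∈ unitaryGroup (Fin 4) ℂ)
    {x y : Fin 6 → ℝ} (h : u * skewOf x * uᵀ = skewOf y) :
    u * skewOf x = skewOf y * u.map star := by
  have h1 : uᵀ * u.map star = 1 := by
    have := congrArg transpose ((mem_unitaryGroup_iff').1 hu)
    rwa [transpose_mul, transpose_one, star_eq_conjTranspose, conjTranspose, transpose_map,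
      transpose_transpose] at this
  rw [← h, mul_assoc, h1, mul_one]

/-- The kernel of the vector representation is `{1, -1}`. -/
theorem Covers.eq_one_or_eq_neg_one {u : Matrix (Fin 4) (Fin 4) ℂ}
    (hu : u ∈ unitaryGroup (Fin 4) ℂ) (h : Covers u 1) : u = 1 ∨ u = -1 := by
  have hx : ∀ x, u * skewOf x = skewOf x * u.map star := fun x =>
    mul_skewOf_eq hu ((h x).trans (by rw [one_mulVec]))
  -- The relation `u B = B ū` is complex-linear in `B`, so it passes from the real space of the
  -- `skewOf x` to its complex span, which contains the elementary skew matrices.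
  have hB : ∀ (k l : Fin 4) (x y : Fin 6 → ℝ),
      (single k l 1 - single l k 1 : Matrix (Fin 4) (Fin 4) ℂ) =
        skewOf x + Complex.I • skewOf y → ∀ i j,
      (u * (single k l 1 - single l k 1 : Matrix (Fin 4) (Fin 4) ℂ)) i j =
        ((single k l 1 - single l k 1 : Matrix (Fin 4) (Fin 4) ℂ) * u.map star) i j :=
      fun k l x y hkl i j => by
    rw [hkl, mul_add, add_mul, mul_smul_comm, smul_mul_assoc, hx, hx]
  have h01 := hB 0 1 ![0, 0, 0, 1 / 2, 0, 0] ![0, 0, 0, 0, 1 / 2, 0] (by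
    ext i j
    fin_cases i <;> fin_cases j <;> simp [skewOf, Complex.ext_iff] <;> norm_num)
  have h23 := hB 2 3 ![0, 0, 0, 1 / 2, 0, 0] ![0, 0, 0, 0, -1 / 2, 0] (by
    ext i j
    fin_cases i <;> fin_cases j <;> simp [skewOf, Complex.ext_iff] <;> norm_num)
  have h02 := hB 0 2 ![0, -1 / 2, 0, 0, 0, 0] ![1 / 2, 0, 0, 0, 0, 0] (by
    ext i j
    fin_cases i <;> fin_cases j <;> simp [skewOf, Complex.ext_iff] <;> norm_num)
  have h13 := hB 1 3 ![0, 1 / 2, 0, 0, 0, 0] ![1 / 2, 0, 0, 0, 0, 0] (by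
    ext i j
    fin_cases i <;> fin_cases j <;> simp [skewOf, Complex.ext_iff] <;> norm_num)
  have h12 := hB 1 2 ![0, 0, -1 / 2, 0, 0, 0] ![0, 0, 0, 0, 0, 1 / 2] (by
    ext i j
    fin_cases i <;> fin_cases j <;> simp [skewOf, Complex.ext_iff] <;> norm_num)
  -- In a row other than `k` and `l` the right side vanishes, which kills the off-diagonal entries
  -- of `u`. The rows `k` themselves relate diagonal entries to conjugates of diagonal entries.
  have a20 := h01 2 1
  have a30 := h01 3 1
  have a21 := h01 2 0
  have a31 := h01 3 0
  have a02 := h23 0 3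
  have a12 := h23 1 3
  have a03 := h23 0 2
  have a13 := h23 1 2
  have a10 := h02 1 2
  have a32 := h02 3 0
  have a01 := h13 0 3
  have a23 := h13 2 1
  have d01 := h01 0 1
  have d02 := h02 0 2
  have d12 := h12 1 2
  have d13 := h13 1 3
  simp [mul_apply, single_apply] at a20 a30 a21 a31 a02 a12 a03 a13 a10 a32
  simp [mul_apply, single_apply] at a01 a23 d01 d02 d12 d13
  have e22 : u 2 2 = u 1 1 := by
    rw [← Complex.conj_conj (u 2 2), ← d02, d01, Complex.conj_conj]
  have e11 : u 1 1 = u 0 0 := by rw [d12, d02]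
  have e33 : u 3 3 = u 0 0 := by
    rw [← Complex.conj_conj (u 3 3), ← d13, ← d01]
  -- The diagonal entries are all equal and real, so the first row having norm one leaves only `±1`.
  have hsq : u 0 0 * u 0 0 = 1 := by
    have hun : (u * star u) 0 0 = 1 := by rw [(mem_unitaryGroup_iff).1 hu, one_apply_eq]
    have h1 : starRingEnd ℂ (u 0 0) = u 0 0 := by
      rw [← e11]
      conv_rhs => rw [e11, d01]
    simpa [mul_apply, star_apply, Fin.sum_univ_four, a01, a02, a03, h1] using hun
  rcases mul_self_eq_one_iff.1 hsq with h1 | h1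
  · left
    ext i j
    fin_cases i <;> fin_cases j <;> simp [a20, a30, a21, a31, a02, a12, a03, a13, a10, a32, a01,
      a23, e22, e11, e33, h1]
  · right
    ext i j
    fin_cases i <;> fin_cases j <;> simp [a20, a30, a21, a31, a02, a12, a03, a13, a10, a32, a01,
      a23, e22, e11, e33, h1]

/-! ### The covering of connected subgroups -/

theorem isCompact_specialUnitaryGroup {n : Type*} [Fintype n] [DecidableEq n] :
    IsCompact (specialUnitaryGroup n ℂ : Set (Matrix n n ℂ)) := by
  have hsub : (specialUnitaryGroup n ℂ : Set (Matrix n n ℂ)) ⊆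
      Set.pi Set.univ fun _ => Set.pi Set.univ fun _ => Metric.closedBall (0 : ℂ) 1 :=
    fun u hu i _ j _ => by
      rw [mem_closedBall_zero_iff]
      exact entry_norm_bound_of_unitary (specialUnitaryGroup_le_unitaryGroup hu) i j
  refine (isCompact_univ_pi fun _ => isCompact_univ_pi fun _ =>
    isCompact_closedBall _ _).of_isClosed_subset ?_ hsub
  have h : (specialUnitaryGroup n ℂ : Set (Matrix n n ℂ)) =
      {u | u * star u = 1} ∩ {u | u.det = 1} := by
    ext u
    exact mem_specialUnitaryGroup_iff.trans (and_congr_left' mem_unitaryGroup_iff)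
  rw [h]
  exact (isClosed_eq (by fun_prop) continuous_const).inter
    (isClosed_eq (by fun_prop) continuous_const)

instance {n : Type*} [Fintype n] [DecidableEq n] : CompactSpace (specialUnitaryGroup n ℂ) :=
  isCompact_iff_compactSpace.1 isCompact_specialUnitaryGroup

instance {n : Type*} [Fintype n] [DecidableEq n] :
    IsTopologicalGroup (specialUnitaryGroup n ℂ) where
  continuous_mul := Continuous.subtype_mk (by fun_prop) _
  continuous_inv := Continuous.subtype_mk
    (f := fun u : specialUnitaryGroup n ℂ => star u.1) (by fun_prop) _

variable {h : LieSubalgebra ℝ so6}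

theorem exists_covers_of_mem_connectedSubgroupSU {u : specialUnitaryGroup (Fin 4) ℂ}
    (hu : u ∈ connectedSubgroupSU (h.map spinEquiv.toLieHom)) :
    ∃ g ∈ connectedSubgroupSO h, Covers u.1 g.1 := by
  induction hu using Subgroup.closure_induction with
  | mem u hu =>
    obtain ⟨A, hA, hu⟩ := hu
    obtain ⟨X, hX, rfl⟩ := (LieSubalgebra.mem_map _ _ _).1 hA
    refine ⟨⟨NormedSpace.exp X.1, exp_mem_specialOrthogonalGroup
      ((LieAlgebra.Orthogonal.mem_so (Fin 6) ℝ X.1).1 X.2)⟩,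
      Subgroup.subset_closure ⟨X, hX, rfl⟩, ?_⟩
    rw [hu]
    exact covers_exp X
  | one => exact ⟨1, one_mem _, Covers.one⟩
  | mul u v _ _ hu hv =>
    obtain ⟨g, hg, hgu⟩ := hu
    obtain ⟨k, hk, hkv⟩ := hv
    exact ⟨g * k, mul_mem hg hk, hgu.mul hkv⟩
  | inv u _ hu =>
    obtain ⟨g, hg, hgu⟩ := hu
    refine ⟨g⁻¹, inv_mem hg, fun x => ?_⟩
    have h1 : (u⁻¹).1 * u.1 = 1 := congrArg Subtype.val (inv_mul_cancel u)
    have h2 : g.1 * (g⁻¹).1 = 1 := congrArg Subtype.val (mul_inv_cancel g)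
    have h3 : (u.1)ᵀ * ((u⁻¹).1)ᵀ = 1 := by rw [← transpose_mul, h1, transpose_one]
    have h4 : skewOf x = u.1 * skewOf ((g⁻¹).1 *ᵥ x) * (u.1)ᵀ := by
      rw [hgu, mulVec_mulVec, h2, one_mulVec]
    calc (u⁻¹).1 * skewOf x * ((u⁻¹).1)ᵀ
        = ((u⁻¹).1 * u.1) * skewOf ((g⁻¹).1 *ᵥ x) * ((u.1)ᵀ * ((u⁻¹).1)ᵀ) := by
          rw [h4]; simp only [mul_assoc]
      _ = _ := by rw [h1, h3, one_mul, mul_one]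

theorem exists_covers_of_mem_connectedSubgroupSO {g : specialOrthogonalGroup (Fin 6) ℝ}
    (hg : g ∈ connectedSubgroupSO h) :
    ∃ u ∈ connectedSubgroupSU (h.map spinEquiv.toLieHom), Covers u.1 g.1 := by
  induction hg using Subgroup.closure_induction with
  | mem g hg =>
    obtain ⟨X, hX, hg⟩ := hg
    refine ⟨⟨NormedSpace.exp (spinMatrix X.1), exp_mem_specialUnitaryGroup
      (spinMatrix_mem X.1).1 (spinMatrix_mem X.1).2⟩, Subgroup.subset_closure
      ⟨spinEquiv X, (LieSubalgebra.mem_map _ _ _).2 ⟨X, hX, rfl⟩, rfl⟩, ?_⟩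
    rw [hg]
    exact covers_exp X
  | one => exact ⟨1, one_mem _, Covers.one⟩
  | mul g k _ _ hg hk =>
    obtain ⟨u, hu, hgu⟩ := hg
    obtain ⟨v, hv, hkv⟩ := hk
    exact ⟨u * v, mul_mem hu hv, hgu.mul hkv⟩
  | inv g _ hg =>
    -- The inverse of `u` covers some `k`. Then `u u⁻¹ = 1` covers `g k`, and uniqueness gives `k =
    -- g⁻¹`.
    obtain ⟨u, hu, hgu⟩ := hg
    obtain ⟨k, hk, hku⟩ := exists_covers_of_mem_connectedSubgroupSU (inv_mem hu)
    refine ⟨u⁻¹, inv_mem hu, ?_⟩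
    have h1 : Covers 1 (g.1 * k.1) := by
      have := hgu.mul hku
      rwa [show u.1 * (u⁻¹).1 = 1 from congrArg Subtype.val (mul_inv_cancel u)] at this
    have h2 : g * k = 1 := Subtype.ext (h1.unique Covers.one)
    rwa [inv_eq_of_mul_eq_one_right h2]

variable (h) in
/-- The covering homomorphism between the connected subgroups of `SU(4)` and `SO(6)`. -/
def coveringHom : connectedSubgroupSU (h.map spinEquiv.toLieHom) →* connectedSubgroupSO h :=
  MonoidHom.mk'
    (fun u => ⟨(exists_covers_of_mem_connectedSubgroupSU u.2).choose,
      (exists_covers_of_mem_connectedSubgroupSU u.2).choose_spec.1⟩)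
    -- The chosen values are multiplicative because a matrix covers at most one `g`.
    (fun u v => Subtype.ext (Subtype.ext
      ((exists_covers_of_mem_connectedSubgroupSU (u * v).2).choose_spec.2.unique
        ((exists_covers_of_mem_connectedSubgroupSU u.2).choose_spec.2.mul
          (exists_covers_of_mem_connectedSubgroupSU v.2).choose_spec.2))))

theorem covers_coveringHom (u : connectedSubgroupSU (h.map spinEquiv.toLieHom)) :
    Covers u.1.1 (coveringHom h u).1.1 :=
  (exists_covers_of_mem_connectedSubgroupSU u.2).choose_spec.2

theorem coveringHom_surjective : Function.Surjective (coveringHom h) := fun g => by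
  obtain ⟨u, hu, hug⟩ := exists_covers_of_mem_connectedSubgroupSO g.2
  exact ⟨⟨u, hu⟩, Subtype.ext (Subtype.ext ((covers_coveringHom ⟨u, hu⟩).unique hug))⟩

theorem coveringHom_continuous : Continuous (coveringHom h) := by
  have h1 : Continuous fun u : connectedSubgroupSU (h.map spinEquiv.toLieHom) =>
      Matrix.of fun a b => vectorRep (Matrix.of u.1.1) a b :=
    contDiff_vectorRep.continuous.comp (Continuous.comp
      (g := fun u : specialUnitaryGroup (Fin 4) ℂ => u.1) continuous_subtype_val continuous_subtype_val)
  refine Continuous.subtype_mk (Continuous.subtype_mk (h1.congr fun u => ?_) _) _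
  exact (covers_coveringHom u).vectorRep_eq

/-- The element `-1` of `SU(4)`. -/
def negOne : specialUnitaryGroup (Fin 4) ℂ :=
  ⟨-1, mem_specialUnitaryGroup_iff.2 ⟨mem_unitaryGroup_iff.2 (by simp), by
    rw [det_neg]; simp [Even.neg_one_pow (show Even 4 by decide)]⟩⟩

theorem negOne_ne_one : negOne ≠ 1 := fun h => by
  have := congrArg (fun u : specialUnitaryGroup (Fin 4) ℂ => (u.1 0 0).re) h
  simp [negOne] at this
  norm_num at this

theorem coveringHom_eq_one_iff (hneg : negOne ∈ connectedSubgroupSU (h.map spinEquiv.toLieHom))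
    (u : connectedSubgroupSU (h.map spinEquiv.toLieHom)) :
    coveringHom h u = 1 ↔ u = 1 ∨ u = ⟨negOne, hneg⟩ := by
  constructor
  · intro hu
    have h1 := covers_coveringHom u
    rw [hu] at h1
    rcases h1.eq_one_or_eq_neg_one (specialUnitaryGroup_le_unitaryGroup u.1.2) with h2 | h2
    · exact Or.inl (Subtype.ext (Subtype.ext h2))
    · exact Or.inr (Subtype.ext (Subtype.ext h2))
  · rintro (rfl | rfl)
    · exact map_one _
    · exact Subtype.ext (Subtype.ext ((covers_coveringHom _).unique Covers.one.neg))

/-- A continuous surjection from a compact space to a Hausdorff one is closed, hence a quotient map,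
and a quotient homomorphism with discrete kernel is a covering. The fibres are the cosets `{u, -u}`
of the kernel. -/
theorem isTwofoldCoveringEpimorphism_coveringHom
    (hneg : negOne ∈ connectedSubgroupSU (h.map spinEquiv.toLieHom))
    (hclosed : IsClosed (connectedSubgroupSU (h.map spinEquiv.toLieHom) :
      Set (specialUnitaryGroup (Fin 4) ℂ))) :
    IsTwofoldCoveringEpimorphism (coveringHom h) := by
  have hcompact : CompactSpace (connectedSubgroupSU (h.map spinEquiv.toLieHom)) :=
    isCompact_iff_compactSpace.1 hclosed.isCompact
  have hker : ((coveringHom h).ker : Set (connectedSubgroupSU (h.map spinEquiv.toLieHom))) =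
      {1, ⟨negOne, hneg⟩} := by
    ext u
    exact (MonoidHom.mem_ker).trans (coveringHom_eq_one_iff hneg u)
  refine ⟨⟨_, contDiff_vectorRep, fun u => ?_⟩, coveringHom_surjective, ?_, fun g => ?_⟩
  · ext a b
    exact congrFun (congrFun (covers_coveringHom u).vectorRep_eq a) b
  · have hq : Topology.IsQuotientMap (coveringHom h) :=
      coveringHom_continuous.isClosedMap.isQuotientMap coveringHom_continuous
        coveringHom_surjective
    refine (hq.isQuotientCoveringMap_of_isDiscrete_ker_monoidHom ?_).isCoveringMap
    rw [hker]
    exact (Set.toFinite _).isDiscrete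
  · obtain ⟨u, rfl⟩ := coveringHom_surjective g
    have hfib : (coveringHom h) ⁻¹' {coveringHom h u} = {u, u * ⟨negOne, hneg⟩} := by
      ext v
      have h1 : coveringHom h v = coveringHom h u ↔ coveringHom h (u⁻¹ * v) = 1 := by
        rw [map_mul, map_inv, inv_mul_eq_one, eq_comm]
      rw [Set.mem_preimage, Set.mem_singleton_iff, h1, coveringHom_eq_one_iff hneg,
        inv_mul_eq_one, inv_mul_eq_iff_eq_mul, Set.mem_insert_iff, Set.mem_singleton_iff,
        eq_comm (a := u)]
    rw [hfib, Nat.card_coe_set_eq, Set.ncard_pair]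
    intro h1
    exact negOne_ne_one (congrArg Subtype.val (mul_eq_left.1 h1.symm))

theorem isClosed_connectedSubgroupSO
    (hclosed : IsClosed (connectedSubgroupSU (h.map spinEquiv.toLieHom) :
      Set (specialUnitaryGroup (Fin 4) ℂ))) :
    IsClosed (connectedSubgroupSO h : Set (specialOrthogonalGroup (Fin 6) ℝ)) := by
  have hcompact : CompactSpace (connectedSubgroupSU (h.map spinEquiv.toLieHom)) :=
    isCompact_iff_compactSpace.1 hclosed.isCompact
  have h1 : IsCompact (Set.range fun u => (coveringHom h u).1) :=
    isCompact_range (continuous_subtype_val.comp coveringHom_continuous)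
  convert h1.isClosed
  ext g
  constructor
  · intro hg
    obtain ⟨u, hu⟩ := coveringHom_surjective ⟨g, hg⟩
    exact ⟨u, congrArg Subtype.val hu⟩
  · rintro ⟨u, rfl⟩
    exact (coveringHom h u).2

theorem mem_connectedSubgroupSU_of_exp {k : LieSubalgebra ℝ su4} {A : su4} (hA : A ∈ k)
    (u : specialUnitaryGroup (Fin 4) ℂ) (hu : u.1 = NormedSpace.exp A.1) :
    u ∈ connectedSubgroupSU k :=
  Subgroup.subset_closure ⟨A, hA, hu⟩

theorem uK₃_mul_self : ((2 : ℝ) • uK₃.1) * ((2 : ℝ) • uK₃.1) = -1 := by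
  ext i j
  fin_cases i <;> fin_cases j <;>
    simp [uK₃, mul_apply, Fin.sum_univ_four]

/-- Since `2K₃` squares to `-1`, Euler's formula gives `exp (2π K₃) = cos π = -1`. -/
theorem negOne_mem {k : LieSubalgebra ℝ su4} (hk : uK₃ ∈ k) : negOne ∈ connectedSubgroupSU k := by
  refine mem_connectedSubgroupSU_of_exp (k.smul_mem (2 * Real.pi) hk) _ ?_
  have h1 : ((2 * Real.pi) • uK₃ : su4).1 = Real.pi • ((2 : ℝ) • uK₃.1) := by
    rw [smul_smul, mul_comm]; rfl
  rw [h1, exp_smul_of_mul_self_eq_neg_one uK₃_mul_self]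
  simp [negOne]

/-- The conclusions of the covering theorem hold once `UG` is closed and contains `-1`. -/
theorem exists_isTwofoldCoveringEpimorphism
    (hK : uK₃ ∈ h.map spinEquiv.toLieHom)
    (hclosed : IsClosed (connectedSubgroupSU (h.map spinEquiv.toLieHom) :
      Set (specialUnitaryGroup (Fin 4) ℂ))) :
    ∃ Ξ : connectedSubgroupSU (h.map spinEquiv.toLieHom) →* connectedSubgroupSO h,
      IsTwofoldCoveringEpimorphism Ξ ∧
      ∀ X ∈ h, ∀ u : connectedSubgroupSU (h.map spinEquiv.toLieHom),
        u.1.1 = NormedSpace.exp (spinEquiv X).1 → (Ξ u).1.1 = NormedSpace.exp X.1 := by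
  refine ⟨coveringHom h, isTwofoldCoveringEpimorphism_coveringHom (negOne_mem hK) hclosed,
    fun X _ u hu => ?_⟩
  have h1 := covers_coveringHom u
  rw [hu] at h1
  exact h1.unique (covers_exp X)

/-! ### Infinitesimal rotations -/

theorem so6_ext {X Y : so6} (h : ∀ a b, a < b → X.1 a b = Y.1 a b) : X = Y := by
  refine Subtype.ext (Matrix.ext fun a b => ?_)
  rcases lt_trichotomy a b with hab | rfl | hab
  · exact h a b hab
  · rw [so6_diag, so6_diag]
  · rw [so6_apply X b a, so6_apply Y b a, h b a hab]

theorem rot_apply (a b i j : Fin 6) : (rot a b).1 i j =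
    (if a = i ∧ b = j then 1 else 0) - (if b = i ∧ a = j then 1 else 0) := by
  simp [rot, single_apply]

theorem rot_swap (a b : Fin 6) : rot a b = -rot b a :=
  Subtype.ext (neg_sub _ _).symm

theorem lie_rot_rot (a b c d : Fin 6) : ⁅rot a b, rot c d⁆ =
    (if b = c then rot a d else 0) - (if b = d then rot a c else 0)
      - (if a = c then rot b d else 0) + (if a = d then rot b c else 0) := by
  have hs : ∀ a b c d : Fin 6, (single a b 1 * single c d 1 : Matrix (Fin 6) (Fin 6) ℝ) =
      if b = c then single a d 1 else 0 := fun a b c d => by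
    split_ifs with h
    · rw [h, single_mul_single_same, one_mul]
    · exact single_mul_single_of_ne _ _ _ _ h _
  refine Subtype.ext ?_
  change (rot a b).1 * (rot c d).1 - (rot c d).1 * (rot a b).1 = _
  simp only [rot, sub_mul, mul_sub, hs]
  split_ifs <;> subst_vars <;> simp_all <;> abel

theorem coe_spinEquiv (X : so6) : (spinEquiv X).1 = spinMatrix X.1 := rfl

theorem spinEquiv_mem_map {h : LieSubalgebra ℝ so6} {X : so6} (hX : X ∈ h) :
    spinEquiv X ∈ h.map spinEquiv.toLieHom :=
  (LieSubalgebra.mem_map _ _ _).2 ⟨X, hX, rfl⟩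

theorem spinEquiv_rot_two_three : spinEquiv (rot 2 3) = uK₃ := by
  refine Subtype.ext ?_
  change spinMatrix (rot 2 3).1 = uK₃.1
  ext i j
  fin_cases i <;> fin_cases j <;>
    simp [spinMatrix, uK₃, rot_apply, half, Complex.ext_iff]

/-! ### The algebra generated by the diagonal rotations and the common boost -/

/-- The complex structure on `ℝ⁶` that pairs the coordinates `a` and `5 - a`. -/
def complexStructure : so6 := rot 0 5 + rot 1 4 + rot 2 3

/-- The unitary algebra `u(3)` in `so(6)`: the centralizer of the complex structure. -/
def unitaryAlgebra : LieSubalgebra ℝ so6 where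
  carrier := {X | ⁅X, complexStructure⁆ = 0}
  add_mem' := fun {X Y} hX hY => by
    rw [Set.mem_ofPred_eq] at *
    rw [add_lie, hX, hY, add_zero]
  zero_mem' := zero_lie _
  smul_mem' := fun c X hX => by
    rw [Set.mem_ofPred_eq] at *
    rw [smul_lie, hX, smul_zero]
  lie_mem' := fun {X Y} hX hY => by
    change ⁅⁅X, Y⁆, complexStructure⁆ = 0
    rw [lie_lie, show ⁅X, complexStructure⁆ = 0 from hX, show ⁅Y, complexStructure⁆ = 0 from hY,
      lie_zero, lie_zero, sub_zero]

theorem mem_unitaryAlgebra {X : so6} : X ∈ unitaryAlgebra ↔ ⁅X, complexStructure⁆ = 0 := Iff.rfl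

theorem generatedJointAlgebra_le : generatedJointAlgebra ≤ unitaryAlgebra := by
  refine LieSubalgebra.lieSpan_le.2 ?_
  rintro X (rfl | rfl | rfl | rfl) <;>
  · refine mem_unitaryAlgebra.2 ?_
    simp only [complexStructure, add_lie, lie_add, lie_rot_rot]
    refine so6_ext fun a b hab => ?_
    simp [rot_apply] <;> ring

/-- Commuting with the complex structure imposes six linear relations on the fifteen entries above
the diagonal, which leaves dimension nine. Brackets of the four generators produce nine spanning
elements. -/
theorem unitaryAlgebra_le : unitaryAlgebra ≤ generatedJointAlgebra := by
  intro X hX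
  have hX' : X.1 * complexStructure.1 = complexStructure.1 * X.1 :=
    sub_eq_zero.1 (congrArg Subtype.val hX)
  have hx : ∀ a b, (X.1 * complexStructure.1) a b = (complexStructure.1 * X.1) a b :=
    fun a b => by rw [hX']
  have e01 := hx 0 4
  have e02 := hx 0 3
  have e12 := hx 1 3
  have s01 := hx 0 1
  have s02 := hx 0 2
  have s12 := hx 1 2
  simp [complexStructure, mul_apply, rot_apply] at e01 e02 e12 s01 s02 s12
  have d12 : rot 1 2 + rot 4 3 ∈ generatedJointAlgebra :=
    LieSubalgebra.subset_lieSpan (by simp)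
  have d02 : rot 0 2 + rot 5 3 ∈ generatedJointAlgebra :=
    LieSubalgebra.subset_lieSpan (by simp)
  have d01 : rot 0 1 + rot 5 4 ∈ generatedJointAlgebra :=
    LieSubalgebra.subset_lieSpan (by simp)
  have r23 : rot 2 3 ∈ generatedJointAlgebra :=
    LieSubalgebra.subset_lieSpan (by simp)
  have t12 : rot 1 3 + rot 2 4 ∈ generatedJointAlgebra := by
    have h := LieSubalgebra.lie_mem _ d12 r23
    convert h using 1
    simp [lie_rot_rot]
    rw [rot_swap 4 2, neg_neg]
  have t02 : rot 0 3 + rot 2 5 ∈ generatedJointAlgebra := by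
    have h := LieSubalgebra.lie_mem _ d02 r23
    convert h using 1
    simp [lie_rot_rot]
    rw [rot_swap 5 2, neg_neg]
  -- The bracket of `d12` and `t12` is `2 (R₁₄ - R₂₃)`; adding `R₂₃` to its half isolates `R₁₄`. The
  -- same device yields `R₀₅`.
  have r14 : rot 1 4 ∈ generatedJointAlgebra := by
    have h := add_mem (LieSubalgebra.smul_mem _ (1 / 2 : ℝ) (LieSubalgebra.lie_mem _ d12 t12)) r23
    convert h using 1
    simp [lie_rot_rot]
    rw [rot_swap 4 1, rot_swap 3 2]
    module
  have r05 : rot 0 5 ∈ generatedJointAlgebra := by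
    have h := add_mem (LieSubalgebra.smul_mem _ (1 / 2 : ℝ) (LieSubalgebra.lie_mem _ d02 t02)) r23
    convert h using 1
    simp [lie_rot_rot]
    rw [rot_swap 5 0, rot_swap 3 2]
    module
  have t01 : rot 0 4 + rot 1 5 ∈ generatedJointAlgebra := by
    have h := LieSubalgebra.lie_mem _ d01 r14
    convert h using 1
    simp [lie_rot_rot]
    rw [rot_swap 5 1, neg_neg]
  have hsum : X = X.1 1 2 • (rot 1 2 + rot 4 3) + X.1 0 2 • (rot 0 2 + rot 5 3)
      + X.1 0 1 • (rot 0 1 + rot 5 4) + X.1 1 3 • (rot 1 3 + rot 2 4)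
      + X.1 0 3 • (rot 0 3 + rot 2 5) + X.1 0 4 • (rot 0 4 + rot 1 5)
      + X.1 0 5 • rot 0 5 + X.1 1 4 • rot 1 4 + X.1 2 3 • rot 2 3 := by
    have x54 := so6_apply X 4 5
    have x53 := so6_apply X 3 5
    have x43 := so6_apply X 3 4
    have x51 := so6_apply X 1 5
    have x52 := so6_apply X 2 5
    have x42 := so6_apply X 2 4
    refine so6_ext fun a b hab => ?_
    fin_cases a <;> fin_cases b <;> first
    | exact absurd hab (by decide)
    | simp [rot_apply]
      try linarith
  rw [hsum]
  exact add_mem (add_mem (add_mem (add_mem (add_mem (add_mem (add_mem (add_mem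
    (LieSubalgebra.smul_mem _ _ d12) (LieSubalgebra.smul_mem _ _ d02))
    (LieSubalgebra.smul_mem _ _ d01)) (LieSubalgebra.smul_mem _ _ t12))
    (LieSubalgebra.smul_mem _ _ t02)) (LieSubalgebra.smul_mem _ _ t01))
    (LieSubalgebra.smul_mem _ _ r05)) (LieSubalgebra.smul_mem _ _ r14))
    (LieSubalgebra.smul_mem _ _ r23)

theorem generatedJointAlgebra_eq : generatedJointAlgebra = unitaryAlgebra :=
  le_antisymm generatedJointAlgebra_le unitaryAlgebra_le

/-! ### The group of the unitary algebra as a centralizer in `SU(4)`. -/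

theorem commute_of_mem_map_unitaryAlgebra {A : su4}
    (hA : A ∈ unitaryAlgebra.map spinEquiv.toLieHom) :
    Commute A.1 (spinEquiv complexStructure).1 := by
  obtain ⟨X, hX, rfl⟩ := (LieSubalgebra.mem_map _ _ _).1 hA
  have h1 : ⁅spinEquiv X, spinEquiv complexStructure⁆ = 0 := by
    have h2 := LieHom.map_lie spinEquiv.toLieHom X complexStructure
    rw [mem_unitaryAlgebra.1 hX, map_zero] at h2
    exact h2.symm
  exact sub_eq_zero.1 (congrArg Subtype.val h1)

theorem mem_map_unitaryAlgebra_of_commute {A : su4}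
    (hA : Commute A.1 (spinEquiv complexStructure).1) :
    A ∈ unitaryAlgebra.map spinEquiv.toLieHom := by
  obtain ⟨X, rfl⟩ := spinEquiv.surjective A
  refine spinEquiv_mem_map (mem_unitaryAlgebra.2 (spinEquiv.injective ?_))
  have h2 : ⁅spinEquiv X, spinEquiv complexStructure⁆ = 0 := Subtype.ext (sub_eq_zero.2 hA)
  rw [map_zero, ← h2]
  exact LieHom.map_lie spinEquiv.toLieHom X complexStructure

/-- The reflection in the hyperplane orthogonal to the line that is fixed by the unitary
algebra. -/
def lineReflection : Matrix (Fin 4) (Fin 4) ℂ :=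
  (1 / 2 : ℂ) • 1 + Complex.I • (spinEquiv complexStructure).1

theorem lineReflection_mul_self : lineReflection * lineReflection = 1 := by
  have h : lineReflection = (1 / 2 : ℂ) • !![1, Complex.I, -Complex.I, 1;
      -Complex.I, 1, 1, Complex.I; Complex.I, 1, 1, -Complex.I;
      1, -Complex.I, Complex.I, 1] := by
    ext i j
    fin_cases i <;> fin_cases j <;>
      simp [lineReflection, coe_spinEquiv, spinMatrix, complexStructure, rot_apply, half,
        Complex.ext_iff]
  rw [h]
  ext i j
  fin_cases i <;> fin_cases j <;>
    simp [mul_apply, Fin.sum_univ_four, Complex.ext_iff] <;> norm_num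

/-- Since the reflection squares to `1`, the eigenvalues of `1 - lineReflection` are among `0` and
`2`, so all exponents lie in `2πiℤ`. Such terms shift the trace of a logarithm without changing its
exponential. -/
theorem exp_int_mul_one_sub_lineReflection (k : ℤ) :
    NormedSpace.exp ((k * Real.pi : ℝ) • (Complex.I • (1 - lineReflection))) = 1 := by
  have hI : (Complex.I • (1 : Matrix (Fin 4) (Fin 4) ℂ)) * (Complex.I • 1) = -1 := by
    rw [smul_mul_smul_comm, Complex.I_mul_I, one_mul, neg_one_smul]
  have hR : (Complex.I • lineReflection) * (Complex.I • lineReflection) = -1 := by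
    rw [smul_mul_smul_comm, Complex.I_mul_I, lineReflection_mul_self, neg_one_smul]
  have h : (k * Real.pi : ℝ) • (Complex.I • (1 - lineReflection)) =
      (k * Real.pi : ℝ) • (Complex.I • (1 : Matrix (Fin 4) (Fin 4) ℂ)) +
        (-(k * Real.pi) : ℝ) • (Complex.I • lineReflection) := by
    module
  have hc : Commute ((k * Real.pi : ℝ) • (Complex.I • (1 : Matrix (Fin 4) (Fin 4) ℂ)))
      ((-(k * Real.pi) : ℝ) • (Complex.I • lineReflection)) :=
    ((((Commute.one_left _).smul_left _).smul_left _).smul_right _).smul_right _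
  rw [h, exp_add_of_commute _ _ hc, exp_smul_of_mul_self_eq_neg_one hI,
    exp_smul_of_mul_self_eq_neg_one hR, Real.sin_neg, Real.cos_neg, Real.sin_int_mul_pi, neg_zero,
    zero_smul, zero_smul, add_zero, smul_mul_smul_comm, one_mul]
  have h1 := Real.cos_sq_add_sin_sq (k * Real.pi)
  rw [Real.sin_int_mul_pi] at h1
  rw [show Real.cos (k * Real.pi) * Real.cos (k * Real.pi) = 1 by linarith, one_smul]

/-- The centralizer is the connected group `S(U(3) × U(1))`. A unitary logarithm of `u` within the
commutant of `φ(J)` may have nonzero trace; a correction that is a multiple of `i (1 -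
lineReflection)` stays in this commutant and removes the trace. -/
theorem mem_connectedSubgroupSU_unitaryAlgebra_iff (u : specialUnitaryGroup (Fin 4) ℂ) :
    u ∈ connectedSubgroupSU (unitaryAlgebra.map spinEquiv.toLieHom) ↔
      u.1 * (spinEquiv complexStructure).1 = (spinEquiv complexStructure).1 * u.1 := by
  constructor
  · intro hu
    change Commute u.1 _
    induction hu using Subgroup.closure_induction with
    | mem u hu =>
      obtain ⟨A, hA, hu⟩ := hu
      rw [hu]
      exact (commute_of_mem_map_unitaryAlgebra hA).exp_left
    | one => exact Commute.one_left _
    | mul u v _ _ hu hv => exact hu.mul_left hv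
    | inv u _ hu =>
      have h1 : (u⁻¹).1 * u.1 = 1 := congrArg Subtype.val (inv_mul_cancel u)
      have h2 : u.1 * (u⁻¹).1 = 1 := congrArg Subtype.val (mul_inv_cancel u)
      exact Commute.units_inv_left (u := ⟨u.1, (u⁻¹).1, h2, h1⟩) hu
  · intro hu
    obtain ⟨A, hA, hAu, hc⟩ :=
      exists_log_of_mem_unitaryGroup (specialUnitaryGroup_le_unitaryGroup u.2)
    have hcA : Commute (spinEquiv complexStructure).1 A := hc _ hu.symm
    have hZ := (spinEquiv complexStructure).2
    obtain ⟨k, hk⟩ : ∃ k : ℤ, A.trace = k * (2 * Real.pi * Complex.I) := by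
      rw [← Complex.exp_eq_one_iff, ← det_exp_of_conjTranspose_eq_neg hA, hAu]
      exact (mem_specialUnitaryGroup_iff.1 u.2).2
    have hRc : Commute A lineReflection :=
      ((Commute.one_right A).smul_right _).add_right (hcA.symm.smul_right _)
    have hRZ : Commute lineReflection (spinEquiv complexStructure).1 :=
      ((Commute.one_left _).smul_left _).add_left ((Commute.refl _).smul_left _)
    have hRstar : lineReflectionᴴ = lineReflection := by
      rw [lineReflection, conjTranspose_add, conjTranspose_smul, conjTranspose_smul, hZ.1]
      simp
    have hRtr : lineReflection.trace = 2 := by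
      rw [lineReflection, trace_add, trace_smul, trace_smul, hZ.2]
      simp
      norm_num
    -- The matrix `i (1 - lineReflection)` has trace `2i`, so `B` has trace `-2πik`, opposite to
    -- that of `A`.
    set B : Matrix (Fin 4) (Fin 4) ℂ :=
      ((-k : ℤ) * Real.pi : ℝ) • (Complex.I • (1 - lineReflection)) with hB
    have hBA : Commute A B :=
      (((Commute.one_right A).sub_right hRc).smul_right _).smul_right _
    have hBZ : Commute B (spinEquiv complexStructure).1 :=
      (((Commute.one_left _).sub_left hRZ).smul_left _).smul_left _
    have hmem : A + B ∈ su4 := by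
      refine ⟨?_, ?_⟩
      · rw [conjTranspose_add, hA, hB, conjTranspose_smul, conjTranspose_smul, conjTranspose_sub,
          hRstar]
        simp
        abel
      · rw [trace_add, hk, hB, trace_smul, trace_smul, trace_sub, hRtr]
        simp
        ring
    refine mem_connectedSubgroupSU_of_exp (A := ⟨A + B, hmem⟩)
      (mem_map_unitaryAlgebra_of_commute (hcA.symm.add_left hBZ)) u ?_
    change u.1 = NormedSpace.exp (A + B)
    rw [exp_add_of_commute _ _ hBA, hAu, hB, exp_int_mul_one_sub_lineReflection, mul_one]

theorem isClosed_connectedSubgroupSU_unitaryAlgebra :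
    IsClosed (connectedSubgroupSU (unitaryAlgebra.map spinEquiv.toLieHom) :
      Set (specialUnitaryGroup (Fin 4) ℂ)) := by
  have h : (connectedSubgroupSU (unitaryAlgebra.map spinEquiv.toLieHom) :
      Set (specialUnitaryGroup (Fin 4) ℂ)) =
      {u | u.1 * (spinEquiv complexStructure).1 = (spinEquiv complexStructure).1 * u.1} :=
    Set.ext mem_connectedSubgroupSU_unitaryAlgebra_iff
  rw [h]
  exact isClosed_eq (by fun_prop) (by fun_prop)

/-! ### The six-dimensional joint algebra -/

/-- The algebra `so(4)` of the infinitesimal rotations that fix the last two coordinates. -/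
def so4 : LieSubalgebra ℝ so6 where
  carrier := {X | ∀ a, X.1 a 4 = 0 ∧ X.1 a 5 = 0}
  add_mem' := fun {X Y} hX hY a => by
    change X.1 a 4 + Y.1 a 4 = 0 ∧ X.1 a 5 + Y.1 a 5 = 0
    rw [(hX a).1, (hX a).2, (hY a).1, (hY a).2, add_zero, and_self]
  zero_mem' := fun a => ⟨rfl, rfl⟩
  smul_mem' := fun c X hX a => by
    change c * X.1 a 4 = 0 ∧ c * X.1 a 5 = 0
    rw [(hX a).1, (hX a).2, mul_zero, and_self]
  lie_mem' := fun {X Y} hX hY a => by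
    change (X.1 * Y.1 - Y.1 * X.1) a 4 = 0 ∧ (X.1 * Y.1 - Y.1 * X.1) a 5 = 0
    simp [mul_apply, fun a => (hX a).1, fun a => (hX a).2, fun a => (hY a).1, fun a => (hY a).2]

theorem spinEquiv_rot_one_two : spinEquiv (rot 1 2) = uJ₁ := by
  refine Subtype.ext ?_
  rw [coe_spinEquiv]
  ext i j
  fin_cases i <;> fin_cases j <;>
    simp [spinMatrix, uJ₁, rot_apply, half, Complex.ext_iff]

theorem spinEquiv_rot_zero_two : spinEquiv (rot 0 2) = uJ₂ := by
  refine Subtype.ext ?_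
  rw [coe_spinEquiv]
  ext i j
  fin_cases i <;> fin_cases j <;>
    simp [spinMatrix, uJ₂, rot_apply, half, Complex.ext_iff]

theorem spinEquiv_rot_zero_one : spinEquiv (rot 0 1) = uJ₃ := by
  refine Subtype.ext ?_
  rw [coe_spinEquiv]
  ext i j
  fin_cases i <;> fin_cases j <;>
    simp [spinMatrix, uJ₃, rot_apply, half, Complex.ext_iff]

theorem spinEquiv_rot_zero_three : spinEquiv (rot 0 3) = uK₁ := by
  refine Subtype.ext ?_
  rw [coe_spinEquiv]
  ext i j
  fin_cases i <;> fin_cases j <;>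
    simp [spinMatrix, uK₁, rot_apply, half, Complex.ext_iff]

theorem spinEquiv_rot_one_three : spinEquiv (rot 1 3) = uK₂ := by
  refine Subtype.ext ?_
  rw [coe_spinEquiv]
  ext i j
  fin_cases i <;> fin_cases j <;>
    simp [spinMatrix, uK₂, rot_apply, half, Complex.ext_iff]

theorem rot_mem_so4 {a b : Fin 6} (ha : a < 4) (hb : b < 4) : rot a b ∈ so4 := fun c => by
  have h : ∀ d : Fin 6, 4 ≤ d → a ≠ d ∧ b ≠ d := fun d hd =>
    ⟨(ha.trans_le hd).ne, (hb.trans_le hd).ne⟩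
  have h4 := h 4 le_rfl
  have h5 := h 5 (by decide)
  rw [rot_apply, rot_apply]
  simp [h4, h5]

/-- The six generators are the images of the `R_ab` with `a < b < 4`, which already form a basis of
`so4`. -/
theorem unitaryJointAlgebra_eq : unitaryJointAlgebra = so4.map spinEquiv.toLieHom := by
  have hmem : ∀ {A}, A ∈ ({uJ₁, uJ₂, uJ₃, uK₁, uK₂, uK₃} : Set su4) → A ∈ unitaryJointAlgebra :=
    fun h => LieSubalgebra.subset_lieSpan h
  refine le_antisymm (LieSubalgebra.lieSpan_le.2 ?_) ?_
  · rintro A (rfl | rfl | rfl | rfl | rfl | rfl)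
    · rw [← spinEquiv_rot_one_two]
      exact spinEquiv_mem_map (rot_mem_so4 (by decide) (by decide))
    · rw [← spinEquiv_rot_zero_two]
      exact spinEquiv_mem_map (rot_mem_so4 (by decide) (by decide))
    · rw [← spinEquiv_rot_zero_one]
      exact spinEquiv_mem_map (rot_mem_so4 (by decide) (by decide))
    · rw [← spinEquiv_rot_zero_three]
      exact spinEquiv_mem_map (rot_mem_so4 (by decide) (by decide))
    · rw [← spinEquiv_rot_one_three]
      exact spinEquiv_mem_map (rot_mem_so4 (by decide) (by decide))
    · rw [← spinEquiv_rot_two_three]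
      exact spinEquiv_mem_map (rot_mem_so4 (by decide) (by decide))
  · intro A hA
    obtain ⟨X, hX, rfl⟩ := (LieSubalgebra.mem_map _ _ _).1 hA
    have hsum : X = X.1 1 2 • rot 1 2 + X.1 0 2 • rot 0 2 + X.1 0 1 • rot 0 1 +
        X.1 0 3 • rot 0 3 + X.1 1 3 • rot 1 3 + X.1 2 3 • rot 2 3 := by
      have h4 : ∀ a, X.1 a 4 = 0 := fun a => (hX a).1
      have h5 : ∀ a, X.1 a 5 = 0 := fun a => (hX a).2
      refine so6_ext fun a b hab => ?_
      fin_cases a <;> fin_cases b <;> first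
      | exact absurd hab (by decide)
      | simp [rot_apply, h4, h5]
    change spinEquiv X ∈ unitaryJointAlgebra
    rw [hsum]
    simp only [map_add, map_smul, spinEquiv_rot_one_two, spinEquiv_rot_zero_two,
      spinEquiv_rot_zero_one, spinEquiv_rot_zero_three, spinEquiv_rot_one_three,
      spinEquiv_rot_two_three]
    exact add_mem (add_mem (add_mem (add_mem (add_mem
      (LieSubalgebra.smul_mem _ _ (hmem (by simp))) (LieSubalgebra.smul_mem _ _ (hmem (by simp))))
      (LieSubalgebra.smul_mem _ _ (hmem (by simp)))) (LieSubalgebra.smul_mem _ _ (hmem (by simp))))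
      (LieSubalgebra.smul_mem _ _ (hmem (by simp)))) (LieSubalgebra.smul_mem _ _ (hmem (by simp)))

theorem jointAlgebra_eq : jointAlgebra = so4 := by
  ext X
  change spinEquiv X ∈ unitaryJointAlgebra ↔ X ∈ so4
  rw [unitaryJointAlgebra_eq]
  refine ⟨fun h => ?_, spinEquiv_mem_map⟩
  obtain ⟨Y, hY, h⟩ := (LieSubalgebra.mem_map _ _ _).1 h
  rwa [← spinEquiv.injective h]

/-- Coordinates on `so4`. -/
def so4Coordinates : so4 →ₗ[ℝ] Fin 6 → ℝ where
  toFun X := ![X.1.1 0 1, X.1.1 0 2, X.1.1 0 3, X.1.1 1 2, X.1.1 1 3, X.1.1 2 3]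
  map_add' X Y := by
    ext i
    fin_cases i <;> rfl
  map_smul' c X := by
    ext i
    fin_cases i <;> rfl

theorem so4Coordinates_bijective : Function.Bijective so4Coordinates := by
  constructor
  · intro X Y h
    have h0 := congrFun h 0
    have h1 := congrFun h 1
    have h2 := congrFun h 2
    have h3 := congrFun h 3
    have h4 := congrFun h 4
    have h5 := congrFun h 5
    simp [so4Coordinates] at h0 h1 h2 h3 h4 h5
    refine Subtype.ext (so6_ext fun a b hab => ?_)
    have x4 : ∀ a, X.1.1 a 4 = 0 := fun a => (X.2 a).1
    have x5 : ∀ a, X.1.1 a 5 = 0 := fun a => (X.2 a).2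
    have y4 : ∀ a, Y.1.1 a 4 = 0 := fun a => (Y.2 a).1
    have y5 : ∀ a, Y.1.1 a 5 = 0 := fun a => (Y.2 a).2
    fin_cases a <;> fin_cases b <;> first
    | exact absurd hab (by decide)
    | assumption
    | exact (x4 _).trans (y4 _).symm
    | exact (x5 _).trans (y5 _).symm
  · intro c
    refine ⟨⟨c 0 • rot 0 1 + c 1 • rot 0 2 + c 2 • rot 0 3 + c 3 • rot 1 2 + c 4 • rot 1 3 +
      c 5 • rot 2 3, ?_⟩, ?_⟩
    · exact add_mem (add_mem (add_mem (add_mem (add_mem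
        (LieSubalgebra.smul_mem _ _ (rot_mem_so4 (by decide) (by decide)))
        (LieSubalgebra.smul_mem _ _ (rot_mem_so4 (by decide) (by decide))))
        (LieSubalgebra.smul_mem _ _ (rot_mem_so4 (by decide) (by decide))))
        (LieSubalgebra.smul_mem _ _ (rot_mem_so4 (by decide) (by decide))))
        (LieSubalgebra.smul_mem _ _ (rot_mem_so4 (by decide) (by decide))))
        (LieSubalgebra.smul_mem _ _ (rot_mem_so4 (by decide) (by decide)))
    · ext i
      fin_cases i <;> simp [so4Coordinates, rot_apply]

theorem finrank_jointAlgebra : Module.finrank ℝ jointAlgebra = 6 := by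
  rw [jointAlgebra_eq]
  exact (LinearEquiv.ofBijective _ so4Coordinates_bijective).finrank_eq.trans (by simp)

theorem map_jointAlgebra : jointAlgebra.map spinEquiv.toLieHom = unitaryJointAlgebra := by
  rw [jointAlgebra_eq, unitaryJointAlgebra_eq]

/-! ### The connected group of the joint algebra -/

-- The curve `exp(tX) v` has derivative `exp(tX) X v = 0`.
open scoped Matrix.Norms.L2Operator in
theorem exp_mulVec_of_mulVec_eq_zero {n : Type*} [Fintype n] [DecidableEq n] {X : Matrix n n ℝ}
    {v : n → ℝ} (hv : X *ᵥ v = 0) : NormedSpace.exp X *ᵥ v = v := by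
  let L : Matrix n n ℝ →ₗ[ℝ] n → ℝ :=
    { toFun := fun Y => Y *ᵥ v
      map_add' := fun Y Z => add_mulVec Y Z v
      map_smul' := fun c Y => smul_mulVec c Y v }
  let L' := LinearMap.toContinuousLinearMap L
  have hL : ∀ Y, L' Y = Y *ᵥ v := fun Y => rfl
  have hf : ∀ t : ℝ, HasDerivAt (fun t : ℝ => L' (NormedSpace.exp (t • X))) 0 t := fun t => by
    refine (L'.hasFDerivAt.comp_hasDerivAt t
      (hasDerivAt_exp_smul_const (𝕂 := ℝ) X t)).congr_deriv ?_
    rw [hL, ← mulVec_mulVec, hv, mulVec_zero]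
  have hconst := is_const_of_deriv_eq_zero (fun t => (hf t).differentiableAt)
    (fun t => (hf t).deriv) 1 0
  simpa [hL] using hconst

theorem fixes_of_mem_connectedSubgroupSU_so4 {u : specialUnitaryGroup (Fin 4) ℂ}
    (hu : u ∈ connectedSubgroupSU (so4.map spinEquiv.toLieHom)) {v : Fin 6 → ℝ}
    (hv : ∀ X ∈ so4, X.1 *ᵥ v = 0) : u.1 * skewOf v * (u.1)ᵀ = skewOf v := by
  obtain ⟨g, hg, hgu⟩ := exists_covers_of_mem_connectedSubgroupSU hu
  rw [hgu]
  congr 1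
  clear hgu hu u
  induction hg using Subgroup.closure_induction with
  | mem g hg =>
    obtain ⟨X, hX, hg⟩ := hg
    rw [hg]
    exact exp_mulVec_of_mulVec_eq_zero (hv X hX)
  | one => exact one_mulVec v
  | mul g k _ _ hg hk =>
    change (g.1 * k.1) *ᵥ v = v
    rw [← mulVec_mulVec, hk, hg]
  | inv g _ hg =>
    have h1 : (g⁻¹).1 * g.1 = 1 := congrArg Subtype.val (inv_mul_cancel g)
    conv_lhs => rw [← hg]
    rw [mulVec_mulVec, h1, one_mulVec]

/-- The imaginary quaternion `n 0 i + n 1 j + n 2 k` as an element of the joint algebra. -/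
def imQuat (n : Fin 3 → ℝ) : Matrix (Fin 4) (Fin 4) ℂ :=
  !![⟨0, n 2⟩, ⟨n 0, n 1⟩, 0, 0; ⟨-n 0, n 1⟩, ⟨0, -n 2⟩, 0, 0;
    0, 0, ⟨0, n 2⟩, ⟨n 0, n 1⟩; 0, 0, ⟨-n 0, n 1⟩, ⟨0, -n 2⟩]

/-- The matrix `σ₂ ⊗ 1`. -/
def chirality : Matrix (Fin 4) (Fin 4) ℂ :=
  !![0, 0, -Complex.I, 0; 0, 0, 0, -Complex.I; Complex.I, 0, 0, 0; 0, Complex.I, 0, 0]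

/-! ### Unit quaternions on the eigenspaces of `chirality`. -/

theorem imQuat_mul_self {n : Fin 3 → ℝ} (hn : n 0 ^ 2 + n 1 ^ 2 + n 2 ^ 2 = 1) :
    imQuat n * imQuat n = -1 := by
  ext i j
  rw [mul_apply, Fin.sum_univ_four]
  fin_cases i <;> fin_cases j <;>
    simp [imQuat, Complex.ext_iff] <;> first
    | linarith
    | constructor <;> linarith

theorem chirality_mul_self : chirality * chirality = 1 := by
  ext i j
  rw [mul_apply, Fin.sum_univ_four]
  fin_cases i <;> fin_cases j <;> simp [chirality]

theorem commute_chirality_imQuat (n : Fin 3 → ℝ) : Commute chirality (imQuat n) := by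
  ext i j
  rw [mul_apply, mul_apply, Fin.sum_univ_four, Fin.sum_univ_four]
  fin_cases i <;> fin_cases j <;> simp [imQuat, chirality, mul_comm]

theorem exists_imQuat_eq (n : Fin 3 → ℝ) (θ : ℝ) :
    ∃ A ∈ unitaryJointAlgebra, A.1 = θ • imQuat n := by
  have hmem : ∀ {A}, A ∈ ({uJ₁, uJ₂, uJ₃, uK₁, uK₂, uK₃} : Set su4) → A ∈ unitaryJointAlgebra :=
    fun h => LieSubalgebra.subset_lieSpan h
  refine ⟨(2 * θ * n 0) • uJ₁ + (2 * θ * n 1) • uJ₂ + (2 * θ * n 2) • uJ₃, add_mem (add_mem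
      (LieSubalgebra.smul_mem _ _ (hmem (by simp))) (LieSubalgebra.smul_mem _ _ (hmem (by simp))))
      (LieSubalgebra.smul_mem _ _ (hmem (by simp))), ?_⟩
  change (2 * θ * n 0) • uJ₁.1 + (2 * θ * n 1) • uJ₂.1 + (2 * θ * n 2) • uJ₃.1 = _
  ext i j
  fin_cases i <;> fin_cases j <;>
    simp [imQuat, uJ₁, uJ₂, uJ₃, Complex.ext_iff] <;> first
    | (constructor <;> ring)
    | ring

theorem exists_chirality_mul_imQuat_eq (n : Fin 3 → ℝ) (θ : ℝ) :
    ∃ A ∈ unitaryJointAlgebra, A.1 = θ • (chirality * imQuat n) := by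
  have hmem : ∀ {A}, A ∈ ({uJ₁, uJ₂, uJ₃, uK₁, uK₂, uK₃} : Set su4) → A ∈ unitaryJointAlgebra :=
    fun h => LieSubalgebra.subset_lieSpan h
  -- The signs come from `K₁ = -QJ₁`, `K₂ = QJ₂`, `K₃ = -QJ₃` with `Q = chirality`.
  refine ⟨(-2 * θ * n 0) • uK₁ + (2 * θ * n 1) • uK₂ + (-2 * θ * n 2) • uK₃, add_mem (add_mem
      (LieSubalgebra.smul_mem _ _ (hmem (by simp))) (LieSubalgebra.smul_mem _ _ (hmem (by simp))))
      (LieSubalgebra.smul_mem _ _ (hmem (by simp))), ?_⟩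
  change (-2 * θ * n 0) • uK₁.1 + (2 * θ * n 1) • uK₂.1 + (-2 * θ * n 2) • uK₃.1 = _
  ext i j
  rw [Matrix.smul_apply, mul_apply, Fin.sum_univ_four]
  fin_cases i <;> fin_cases j <;>
    simp [imQuat, chirality, uK₁, uK₂, uK₃, Complex.ext_iff] <;> first
    | (constructor <;> ring)
    | ring

/-- With the projection `P = (1 + Q)/2`, the two exponents commute and add up to `θ P N`. The
exponential of this is `exp(θN)` on the image of `P` and the identity on its complement. -/
theorem exp_half_mul_exp_half {n : Type*} [Fintype n] [DecidableEq n] {N Q : Matrix n n ℂ}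
    (hN : N * N = -1) (hQ : Q * Q = 1) (h : Commute Q N) (θ : ℝ) :
    NormedSpace.exp ((θ / 2) • N) * NormedSpace.exp ((θ / 2) • (Q * N)) =
      (1 / 2 : ℝ) • ((1 + Q) * (Real.cos θ • (1 : Matrix n n ℂ) + Real.sin θ • N) + (1 - Q)) := by
  have hNQN : N * (Q * N) = -Q := by rw [← mul_assoc, ← h.eq, mul_assoc, hN, mul_neg_one]
  have hQN : (Q * N) * (Q * N) = -1 := by rw [mul_assoc, hNQN, mul_neg, hQ]
  rw [exp_smul_of_mul_self_eq_neg_one hN, exp_smul_of_mul_self_eq_neg_one hQN]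
  have hθ : θ = 2 * (θ / 2) := by ring
  have h1 := Real.cos_two_mul (θ / 2)
  have h2 := Real.sin_two_mul (θ / 2)
  rw [← hθ] at h1 h2
  have h3 := Real.sin_sq_add_cos_sq (θ / 2)
  set c := Real.cos (θ / 2)
  set s := Real.sin (θ / 2)
  have h4 : Real.cos θ = c ^ 2 - s ^ 2 := by linarith
  rw [h4, h2]
  simp only [add_mul, mul_add, smul_mul_assoc, mul_smul_comm, one_mul, mul_one, hNQN, smul_add]
  have h5 : (1 : Matrix n n ℂ) - Q =
      (s ^ 2 + c ^ 2) • (1 : Matrix n n ℂ) - (s ^ 2 + c ^ 2) • Q := by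
    rw [h3, one_smul, one_smul]
  rw [h5]
  module

/-- The polar form of a unit quaternion. -/
theorem exists_polar {a b c d : ℝ} (h : a ^ 2 + b ^ 2 + c ^ 2 + d ^ 2 = 1) :
    ∃ (θ : ℝ) (n : Fin 3 → ℝ), n 0 ^ 2 + n 1 ^ 2 + n 2 ^ 2 = 1 ∧ Real.cos θ = a ∧
      Real.sin θ * n 0 = b ∧ Real.sin θ * n 1 = c ∧ Real.sin θ * n 2 = d := by
  have h1 : -1 ≤ a := by nlinarith [sq_nonneg b, sq_nonneg c, sq_nonneg d]
  have h2 : a ≤ 1 := by nlinarith [sq_nonneg b, sq_nonneg c, sq_nonneg d]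
  have hs := Real.sin_sq_add_cos_sq (Real.arccos a)
  have hc := Real.cos_arccos h1 h2
  rw [hc] at hs
  -- If the sine vanishes, then `a = ±1` and `b = c = d = 0`, so any unit axis serves.
  rcases eq_or_ne (Real.sin (Real.arccos a)) 0 with h0 | h0
  · rw [h0] at hs
    have hb : b = 0 := by nlinarith [sq_nonneg b, sq_nonneg c, sq_nonneg d]
    have hc' : c = 0 := by nlinarith [sq_nonneg b, sq_nonneg c, sq_nonneg d]
    have hd : d = 0 := by nlinarith [sq_nonneg b, sq_nonneg c, sq_nonneg d]
    exact ⟨Real.arccos a, ![1, 0, 0], by simp, hc, by simp [h0, hb], by simp [hc'], by simp [hd]⟩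
  · refine ⟨Real.arccos a, ![b / Real.sin (Real.arccos a), c / Real.sin (Real.arccos a),
      d / Real.sin (Real.arccos a)], ?_, hc, ?_, ?_, ?_⟩
    · simp only [cons_val_zero, cons_val_one, cons_val]
      field_simp
      linarith
    all_goals
      simp only [cons_val_zero, cons_val_one, cons_val]
      field_simp

/-- The group of the unit quaternions acts in either eigenspace of `σ₂ ⊗ 1`. -/
theorem exists_mem_connectedSubgroupSU_chirality {Q : Matrix (Fin 4) (Fin 4) ℂ}
    (hQ : Q = chirality ∨ Q = -chirality) {n : Fin 3 → ℝ} (hn : n 0 ^ 2 + n 1 ^ 2 + n 2 ^ 2 = 1)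
    (θ : ℝ) : ∃ v ∈ connectedSubgroupSU unitaryJointAlgebra, v.1 = (1 / 2 : ℝ) • ((1 + Q) *
      (Real.cos θ • (1 : Matrix (Fin 4) (Fin 4) ℂ) + Real.sin θ • imQuat n) + (1 - Q)) := by
  have hQQ : Q * Q = 1 := by
    rcases hQ with rfl | rfl
    · exact chirality_mul_self
    · rw [neg_mul_neg, chirality_mul_self]
  have hc : Commute Q (imQuat n) := by
    rcases hQ with rfl | rfl
    · exact commute_chirality_imQuat n
    · exact (commute_chirality_imQuat n).neg_left
  obtain ⟨A, hA, hA'⟩ := exists_imQuat_eq n (θ / 2)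
  obtain ⟨B, hB, hB'⟩ : ∃ B ∈ unitaryJointAlgebra, B.1 = (θ / 2) • (Q * imQuat n) := by
    rcases hQ with rfl | rfl
    · exact exists_chirality_mul_imQuat_eq n (θ / 2)
    · obtain ⟨B, hB, hB'⟩ := exists_chirality_mul_imQuat_eq n (-(θ / 2))
      exact ⟨B, hB, by rw [hB', neg_mul, neg_smul, smul_neg]⟩
  refine ⟨⟨_, exp_mem_specialUnitaryGroup A.2.1 A.2.2⟩ *
    ⟨_, exp_mem_specialUnitaryGroup B.2.1 B.2.2⟩,
    mul_mem (mem_connectedSubgroupSU_of_exp hA _ rfl) (mem_connectedSubgroupSU_of_exp hB _ rfl), ?_⟩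
  rw [← exp_half_mul_exp_half (imQuat_mul_self hn) hQQ hc, ← hA', ← hB']
  rfl

/-- With the complementary projections `P = (1 + Q)/2` and `P' = (1 - Q)/2`, this is `(P X + P') (P'
Y + P) = P X + P' Y`. -/
theorem half_mul_half {R : Type*} [Ring R] [Algebra ℝ R] {Q X Y : R} (hQ : Q * Q = 1)
    (hX : Commute Q X) :
    ((1 / 2 : ℝ) • ((1 + Q) * X + (1 - Q))) * ((1 / 2 : ℝ) • ((1 + -Q) * Y + (1 - -Q))) =
      (1 / 2 : ℝ) • (X + Q * X + Y - Q * Y) := by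
  have h1 : (1 + Q) * X = X * (1 + Q) := by rw [mul_add, add_mul, hX.eq]; simp
  have h2 : (1 + Q) * (1 - Q) = 0 := by
    rw [add_mul, mul_sub, mul_sub, hQ]; simp
  have h3 : (1 - Q) * (1 + Q) = 0 := by
    rw [sub_mul, mul_add, mul_add, hQ]; simp [add_comm]
  have h4 : (1 + Q) * (1 + Q) = (2 : ℝ) • (1 + Q) := by
    rw [two_smul, add_mul, mul_add, mul_add, hQ]; simp; abel
  have h5 : (1 - Q) * (1 - Q) = (2 : ℝ) • (1 - Q) := by
    rw [two_smul, sub_mul, mul_sub, mul_sub, hQ]; simp; abel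
  have h6 : ∀ P M : R, (X * P + M) * (M * Y + P) =
      X * (P * M) * Y + X * (P * P) + M * M * Y + M * P := fun P M => by noncomm_ring
  rw [smul_mul_smul_comm, sub_neg_eq_add, ← sub_eq_add_neg, h1, h6, h2, h3, h4, h5, mul_smul_comm,
    smul_mul_assoc, ← h1, add_mul, sub_mul]
  simp only [zero_mul, mul_zero, one_mul]
  module

theorem quaternion_pair_eq (s t : ℝ) (n m : Fin 3 → ℝ) (S T : ℝ) :
    (1 / 2 : ℝ) • ((s • (1 : Matrix (Fin 4) (Fin 4) ℂ) + S • imQuat n) +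
        chirality * (s • (1 : Matrix (Fin 4) (Fin 4) ℂ) + S • imQuat n) +
        (t • (1 : Matrix (Fin 4) (Fin 4) ℂ) + T • imQuat m) -
        chirality * (t • (1 : Matrix (Fin 4) (Fin 4) ℂ) + T • imQuat m)) =
      (1 / 2 : ℝ) • !![
        ⟨s + t, S * n 2 + T * m 2⟩, ⟨S * n 0 + T * m 0, S * n 1 + T * m 1⟩,
        ⟨S * n 2 - T * m 2, t - s⟩, ⟨S * n 1 - T * m 1, T * m 0 - S * n 0⟩;
        ⟨-(S * n 0) - T * m 0, S * n 1 + T * m 1⟩, ⟨s + t, -(S * n 2) - T * m 2⟩,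
        ⟨S * n 1 - T * m 1, S * n 0 - T * m 0⟩, ⟨T * m 2 - S * n 2, t - s⟩;
        ⟨T * m 2 - S * n 2, s - t⟩, ⟨T * m 1 - S * n 1, S * n 0 - T * m 0⟩,
        ⟨s + t, S * n 2 + T * m 2⟩, ⟨S * n 0 + T * m 0, S * n 1 + T * m 1⟩;
        ⟨T * m 1 - S * n 1, T * m 0 - S * n 0⟩, ⟨S * n 2 - T * m 2, s - t⟩,
        ⟨-(S * n 0) - T * m 0, S * n 1 + T * m 1⟩, ⟨s + t, -(S * n 2) - T * m 2⟩] := by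
  congr 1
  ext i j
  rw [Matrix.sub_apply, Matrix.add_apply, Matrix.add_apply, mul_apply,
    mul_apply, Fin.sum_univ_four, Fin.sum_univ_four]
  fin_cases i <;> fin_cases j <;>
    simp [chirality, imQuat, Complex.ext_iff, sub_eq_add_neg, add_comm]

/-- A pair of quaternions as a complex matrix. -/
def quatPair (a b c d : ℂ) : Matrix (Fin 4) (Fin 4) ℂ :=
  !![a, b, c, d; -star b, star a, star d, -star c; -c, -d, a, b; -star d, star c, -star b, star a]

/-- The relation for the fourth vector expresses row 1 through the conjugate of row 0. The relation
for the fifth does so for row 3 through row 0 and for row 2 through row 1. The first row thus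
determines the matrix. -/
theorem eq_quatPair_of_fixes {u : Matrix (Fin 4) (Fin 4) ℂ}
    (h4 : u * skewOf (Pi.single 4 1) = skewOf (Pi.single 4 1) * u.map star)
    (h5 : u * skewOf (Pi.single 5 1) = skewOf (Pi.single 5 1) * u.map star) :
    u = quatPair (u 0 0) (u 0 1) (u 0 2) (u 0 3) := by
  have e : ∀ i j, (u * skewOf (Pi.single 4 1)) i j =
      (skewOf (Pi.single 4 1) * u.map star) i j := fun i j => by rw [h4]
  have f : ∀ i j, (u * skewOf (Pi.single 5 1)) i j =
      (skewOf (Pi.single 5 1) * u.map star) i j := fun i j => by rw [h5]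
  have e00 := e 0 0
  have e01 := e 0 1
  have e02 := e 0 2
  have e03 := e 0 3
  have f00 := f 0 0
  have f01 := f 0 1
  have f02 := f 0 2
  have f03 := f 0 3
  have f10 := f 1 0
  have f11 := f 1 1
  have f12 := f 1 2
  have f13 := f 1 3
  clear e f h4 h5
  simp [mul_apply, Fin.sum_univ_four, skewOf, Complex.ext_iff] at e00 e01 e02 e03
  simp [mul_apply, Fin.sum_univ_four, skewOf, Complex.ext_iff] at f00 f01 f02 f03 f10 f11 f12 f13
  ext i j
  fin_cases i <;> fin_cases j <;> first
  | rfl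
  | (apply Complex.ext <;> simp [quatPair] <;> linarith)

/-- In blocks, `quatPair` is `1 ⊗ q + iσ₂ ⊗ r`, where `q` and `r` have first rows `(a, b)` and `(c,
d)`. On the `±1` eigenspaces of `chirality = σ₂ ⊗ 1` it acts as `q ± i r`; the hypotheses list the
real coordinates of these two quaternions. -/
theorem exp_form_eq_quatPair {a b c d : ℂ} {s t S T : ℝ} {n m : Fin 3 → ℝ}
    (hs : s = a.re - c.im) (h0 : S * n 0 = b.re - d.im) (h1 : S * n 1 = b.im + d.re)
    (h2 : S * n 2 = a.im + c.re) (ht : t = a.re + c.im) (l0 : T * m 0 = b.re + d.im)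
    (l1 : T * m 1 = b.im - d.re) (l2 : T * m 2 = a.im - c.re) :
    (1 / 2 : ℝ) • ((s • (1 : Matrix (Fin 4) (Fin 4) ℂ) + S • imQuat n) +
        chirality * (s • (1 : Matrix (Fin 4) (Fin 4) ℂ) + S • imQuat n) +
        (t • (1 : Matrix (Fin 4) (Fin 4) ℂ) + T • imQuat m) -
        chirality * (t • (1 : Matrix (Fin 4) (Fin 4) ℂ) + T • imQuat m)) = quatPair a b c d := by
  rw [quaternion_pair_eq, h0, h1, h2, l0, l1, l2, hs, ht]
  ext i j
  rw [Matrix.smul_apply]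
  fin_cases i <;> fin_cases j <;> apply Complex.ext <;> simp [quatPair] <;> ring

/-- The entry `(0, 0)` of `u u* = 1` gives the sum of all squares. The imaginary part of the entry
`(0, 2)` makes the cross terms vanish, and these enter the two norms with opposite signs. -/
theorem quatPair_sq_add_sq {a b c d : ℂ} (h : quatPair a b c d ∈ unitaryGroup (Fin 4) ℂ) :
    (a.re - c.im) ^ 2 + (b.re - d.im) ^ 2 + (b.im + d.re) ^ 2 + (a.im + c.re) ^ 2 = 1 ∧
    (a.re + c.im) ^ 2 + (b.re + d.im) ^ 2 + (b.im - d.re) ^ 2 + (a.im - c.re) ^ 2 = 1 := by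
  have n00 := congrArg Complex.re (congrFun (congrFun (mem_unitaryGroup_iff.1 h) 0) 0)
  have n02 := congrArg Complex.im (congrFun (congrFun (mem_unitaryGroup_iff.1 h) 0) 2)
  simp [mul_apply, Fin.sum_univ_four, quatPair, star_apply] at n00 n02
  constructor <;> linarith

/-- The elements of `SU(4)` that fix the last two coordinate vectors belong to the connected group
of the joint algebra. -/
theorem mem_connectedSubgroupSU_of_fixes {u : specialUnitaryGroup (Fin 4) ℂ}
    (h4 : u.1 * skewOf (Pi.single 4 1) * (u.1)ᵀ = skewOf (Pi.single 4 1))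
    (h5 : u.1 * skewOf (Pi.single 5 1) * (u.1)ᵀ = skewOf (Pi.single 5 1)) :
    u ∈ connectedSubgroupSU unitaryJointAlgebra := by
  have hu := specialUnitaryGroup_le_unitaryGroup u.2
  have hq := eq_quatPair_of_fixes (mul_skewOf_eq hu h4) (mul_skewOf_eq hu h5)
  rw [hq] at hu
  obtain ⟨θ, n, hn, hθ, h0, h1, h2⟩ := exists_polar (quatPair_sq_add_sq hu).1
  obtain ⟨η, m, hm, hη, l0, l1, l2⟩ := exists_polar (quatPair_sq_add_sq hu).2
  obtain ⟨v, hv, hv'⟩ := exists_mem_connectedSubgroupSU_chirality (Or.inl rfl) hn θ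
  obtain ⟨w, hw, hw'⟩ := exists_mem_connectedSubgroupSU_chirality (Or.inr rfl) hm η
  have hvw : u = v * w := by
    refine Subtype.ext ?_
    change u.1 = v.1 * w.1
    rw [hv', hw', half_mul_half chirality_mul_self
      (((Commute.one_right _).smul_right _).add_right
        ((commute_chirality_imQuat n).smul_right _)), hq]
    exact (exp_form_eq_quatPair hθ h0 h1 h2 hη l0 l1 l2).symm
  rw [hvw]
  exact mul_mem hv hw

theorem isClosed_connectedSubgroupSU_unitaryJointAlgebra :
    IsClosed (connectedSubgroupSU unitaryJointAlgebra : Set (specialUnitaryGroup (Fin 4) ℂ)) := by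
  have h : (connectedSubgroupSU unitaryJointAlgebra : Set (specialUnitaryGroup (Fin 4) ℂ)) =
      {u | u.1 * skewOf (Pi.single 4 1) * (u.1)ᵀ = skewOf (Pi.single 4 1)} ∩
      {u | u.1 * skewOf (Pi.single 5 1) * (u.1)ᵀ = skewOf (Pi.single 5 1)} := by
    ext u
    refine ⟨fun hu => ?_, fun hu => mem_connectedSubgroupSU_of_fixes hu.1 hu.2⟩
    rw [SetLike.mem_coe, unitaryJointAlgebra_eq] at hu
    refine ⟨fixes_of_mem_connectedSubgroupSU_so4 hu fun X hX => ?_,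
      fixes_of_mem_connectedSubgroupSU_so4 hu fun X hX => ?_⟩
    · rw [mulVec_single_one]
      exact funext fun a => (hX a).1
    · rw [mulVec_single_one]
      exact funext fun a => (hX a).2
  rw [h]
  exact (isClosed_eq (by fun_prop) continuous_const).inter
    (isClosed_eq (by fun_prop) continuous_const)

end Superspin

end

theorem mainTheorem5 :
    Module.finrank ℝ Superspin.jointAlgebra = 6 ∧
    Superspin.jointAlgebra.map Superspin.spinEquiv.toLieHom = Superspin.unitaryJointAlgebra ∧
    ∀ h : LieSubalgebra ℝ Superspin.so6,
      h = Superspin.jointAlgebra ∨ h = Superspin.generatedJointAlgebra →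
      IsClosed (Superspin.connectedSubgroupSU (h.map Superspin.spinEquiv.toLieHom) :
        Set (Matrix.specialUnitaryGroup (Fin 4) ℂ)) ∧
      IsClosed (Superspin.connectedSubgroupSO h :
        Set (Matrix.specialOrthogonalGroup (Fin 6) ℝ)) ∧
      ∃ Ξ : Superspin.connectedSubgroupSU (h.map Superspin.spinEquiv.toLieHom) →*
          Superspin.connectedSubgroupSO h,
        Superspin.IsTwofoldCoveringEpimorphism Ξ ∧
        ∀ X ∈ h, ∀ u : Superspin.connectedSubgroupSU (h.map Superspin.spinEquiv.toLieHom),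
          u.1.1 = NormedSpace.exp (Superspin.spinEquiv X).1 →
          (Ξ u).1.1 = NormedSpace.exp X.1 := by
  refine ⟨Superspin.finrank_jointAlgebra, Superspin.map_jointAlgebra, fun h hh => ?_⟩
  have hclosed : IsClosed (Superspin.connectedSubgroupSU (h.map Superspin.spinEquiv.toLieHom) :
      Set (Matrix.specialUnitaryGroup (Fin 4) ℂ)) := by
    rcases hh with rfl | rfl
    · rw [Superspin.map_jointAlgebra]
      exact Superspin.isClosed_connectedSubgroupSU_unitaryJointAlgebra
    · rw [Superspin.generatedJointAlgebra_eq]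
      exact Superspin.isClosed_connectedSubgroupSU_unitaryAlgebra
  -- Both algebras contain `R₂₃`, whose image `K₃` supplies the element `-1` of the kernel.
  have hK : Superspin.uK₃ ∈ h.map Superspin.spinEquiv.toLieHom := by
    rw [← Superspin.spinEquiv_rot_two_three]
    refine Superspin.spinEquiv_mem_map ?_
    rcases hh with rfl | rfl
    · rw [Superspin.jointAlgebra_eq]
      exact Superspin.rot_mem_so4 (by decide) (by decide)
    · exact LieSubalgebra.subset_lieSpan (by simp)
  exact ⟨hclosed, Superspin.isClosed_connectedSubgroupSO hclosed,
    Superspin.exists_isTwofoldCoveringEpimorphism hK hclosed⟩
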